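/- Let $N,n,k$ be positive integers. Let $\mathbb C[X,A]$ be the polynomial ring in the variables $X^i_j$ $(1\le i,j\le N)$ and $A^a_i$ $(1\le a\le n,\ 1\le i\le N)$, and consider on it the operators $Y^i_j=\partial/\partial X^j_i$ and $B^i_a=\partial/\partial A^a_i$. Let $\mathcal H_N(n,k)\subset\mathbb C[X,A]$ be the subspace of all $f$ with $(\mu^i_j+k\delta^i_j)f=0$ for all $i,j$, where $$\mu^i_j=\sum_{l}X^i_lY^l_j-\sum_l X^l_jY^i_l-\sum_a A^a_jB^i_a ,$$ and let $H_{\mathrm{CS}}=\mathrm{Tr}((XY)^2)=\sum_{i,j,l,m}X^i_lY^l_jX^j_mY^m_i$ (the higher-spin Calogero–Sutherland Hamiltonian). Stack $A$ on top of $X$ to form an $(n+N)\times N$ matrix $M$. The algebra $\mathfrak{gl}_{n+N}\times\mathfrak{gl}_N$ acts on $\mathbb C[X,A]$ through $E^r_s=\sum_l M^r_l\,\partial/\partial M^s_l$ and $F^i_j=-\sum_r M^r_j\,\partial/\partial M^r_i$. For $\lambda=(\lambda_1\ge\dots\ge\lambda_N)\in\mathbb N^N$, let $V^{n+N}_\lambda\otimes(V^N_\lambda)^*\subset\mathbb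 C[X,A]$ be the isotypic component of the irreducible representation with highest weight $(\lambda_1,\dots,\lambda_N,0,\dots,0)$ for $\mathfrak{gl}_{n+N}$ and $(-\lambda_N,\dots,-\lambda_1)$ for $\mathfrak{gl}_N$, and put $\widetilde{\mathcal H}_N(\lambda)=\bigl(V^{n+N}_\lambda\otimes (V^N_\lambda)^*\bigr)\cap\mathcal H_N(n,k)$. Call $\lambda$ admissible if $\lambda_i\ge k$ for all $1\le i\le N$ and $\lambda_i\ge\lambda_{i+n}+k$ for all $1\le i\le N-n$. Then $H_{\mathrm{CS}}$ preserves $\mathcal H_N(n,k)$ and is diagonalized by the direct sum decomposition $$\mathcal H_N(n,k)=\bigoplus_{\lambda\ \text{admissible}}\widetilde{\mathcal H}_N(\lambda).$$ For every admissible $\lambda$ the space $\widetilde{\mathcal H}_N(\lambda)$ is nonzero and $H_{\mathrm{CS}}$ acts on it as the scalar $$\mathcal E(\lambda)=\sum_{i=1}^N(\lambda_i-k)(\lambda_i-k+N+1-2i).$$ Consequently, for every $c\in\mathbb C$, the eigenspace of $H_{\mathrm{CS}}$ on $\mathcal H_N(n,k)$ for the value $c$ is the direct sum of those $\widetilde{\mathcal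 H}_N(\lambda)$, $\lambda$ admissible, with $\mathcal E(\lambda)=c$. -/

import Mathlib

noncomputable section

namespace ChernSimonsMatrix

/-- The polynomial ring `ℂ[X, A]` of functions on `End(ℂ^N) × Hom(ℂ^n, ℂ^N)`, generated by the
entries of the `(n + N) × N` matrix whose first `n` rows form `A` and whose last `N` rows
form `X`. -/
abbrev Poly (N n : ℕ) : Type := MvPolynomial (Fin (n + N) × Fin N) ℂ

/-- Linear operators on `ℂ[X, A]`. -/
abbrev Op (N n : ℕ) : Type := Module.End ℂ (Poly N n)

/-- Multiplication by the `(r, j)` entry of the stacked matrix. -/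
def mulEntry (N n : ℕ) (r : Fin (n + N)) (j : Fin N) : Op N n :=
  LinearMap.mulLeft ℂ (MvPolynomial.X (r, j))

/-- Partial derivative with respect to the `(r, j)` entry of the stacked matrix. -/
def derivEntry (N n : ℕ) (r : Fin (n + N)) (j : Fin N) : Op N n :=
  (MvPolynomial.pderiv (r, j)).toLinearMap

/-- The `N × N` matrix of operators `X^i_j`. -/
def opX (N n : ℕ) : Matrix (Fin N) (Fin N) (Op N n) :=
  Matrix.of fun i j => mulEntry N n (Fin.natAdd n i) j

/-- The `N × N` matrix of operators `Y^i_j = ∂ / ∂X^j_i`. -/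
def opY (N n : ℕ) : Matrix (Fin N) (Fin N) (Op N n) :=
  Matrix.of fun i j => derivEntry N n (Fin.natAdd n j) i

/-- The `n × N` matrix of operators `A^a_i`. -/
def opA (N n : ℕ) : Matrix (Fin n) (Fin N) (Op N n) :=
  Matrix.of fun a i => mulEntry N n (Fin.castAdd N a) i

/-- The `N × n` matrix of operators `B^i_a = ∂ / ∂A^a_i`. -/
def opB (N n : ℕ) : Matrix (Fin N) (Fin n) (Op N n) :=
  Matrix.of fun i a => derivEntry N n (Fin.castAdd N a) i

/-- The moment map
`μ(E^i_j) = ∑ₗ X^i_l Y^l_j - ∑ₗ X^l_j Y^i_l - ∑ₐ A^a_j B^i_a`. -/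
def momentMap (N n : ℕ) (i j : Fin N) : Op N n :=
  (∑ l, opX N n i l * opY N n l j) - (∑ l, opX N n l j * opY N n i l)
    - ∑ a, opA N n a j * opB N n i a

/-- The Hilbert space `H_N(n, k)`: the polynomials `f` with `(μ(E^i_j) + k δ^i_j) f = 0` for
all `i, j`. -/
def hilbert (N n k : ℕ) : Submodule ℂ (Poly N n) :=
  ⨅ (i : Fin N) (j : Fin N),
    LinearMap.ker (momentMap N n i j + if i = j then (k : ℂ) • (1 : Op N n) else 0)

/-- The Hamiltonian `H_CS = Tr((X Y)²)`, a trace of a matrix of operators. -/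
def hamiltonian (N n : ℕ) : Op N n :=
  Matrix.trace ((opX N n * opY N n) ^ 2)

/-- The generators `E^r_s` of the `gl_{n+N}`-action, under which the columns of the stacked matrix
are vectors. -/
def rowGen (N n : ℕ) (r s : Fin (n + N)) : Op N n :=
  ∑ l, mulEntry N n r l * derivEntry N n s l

/-- The generators `F^i_j = - ∑ₐ A^a_j B^i_a - ∑ₗ X^l_j Y^i_l` of the `gl_N`-action, under which
the rows of the stacked matrix are dual vectors. -/
def colGen (N n : ℕ) (i j : Fin N) : Op N n :=
  -∑ r, mulEntry N n r j * derivEntry N n r i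

/-- `W` is a subrepresentation of `ℂ[X, A]` for `gl_{n+N} × gl_N`, equivalently for
`GL_{n+N} × GL_N`. -/
def IsStable (N n : ℕ) (W : Submodule ℂ (Poly N n)) : Prop :=
  (∀ r s, ∀ f ∈ W, rowGen N n r s f ∈ W) ∧ (∀ i j, ∀ f ∈ W, colGen N n i j f ∈ W)

/-- `W` is an irreducible subrepresentation for `gl_{n+N} × gl_N`. -/
def IsIrreducibleSub (N n : ℕ) (W : Submodule ℂ (Poly N n)) : Prop :=
  IsStable N n W ∧ W ≠ ⊥ ∧ ∀ U : Submodule ℂ (Poly N n), IsStable N n U → U ≤ W → U = ⊥ ∨ U = W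

/-- `f` is a highest weight vector for `gl_{n+N} × gl_N` whose weight is the highest weight of
`V_lam ⊗ (V_lam)^*`: the weight `(lam_1, …, lam_N, 0, …, 0)` for `gl_{n+N}` and the weight
`(-lam_N, …, -lam_1)` for `gl_N`. -/
structure IsHighestWeightVector (N n : ℕ) (lam : Fin N → ℕ) (f : Poly N n) : Prop where
  ne_zero : f ≠ 0
  row_raising : ∀ r s, r < s → rowGen N n r s f = 0
  row_weight : ∀ r : Fin (n + N),
    rowGen N n r r f = (if h : (r : ℕ) < N then (lam ⟨r, h⟩ : ℂ) else 0) • f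
  col_raising : ∀ i j, i < j → colGen N n i j f = 0
  col_weight : ∀ i : Fin N, colGen N n i i f = (-(lam i.rev : ℂ)) • f

/-- The summand `V_lam ⊗ (V_lam)^*` of `ℂ[X, A]`: the sum of all irreducible
subrepresentations for `gl_{n+N} × gl_N` that have this highest weight. -/
def component (N n : ℕ) (lam : Fin N → ℕ) : Submodule ℂ (Poly N n) :=
  sSup {W | IsIrreducibleSub N n W ∧ ∃ f ∈ W, IsHighestWeightVector N n lam f}

/-- The subspace `(V_lam ⊗ (V_lam)^*)^{GL_N^diag, -k}`. -/
def hilbertPart (N n k : ℕ) (lam : Fin N → ℕ) : Submodule ℂ (Poly N n) :=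
  component N n lam ⊓ hilbert N n k

/-- Admissible Young diagrams of length `N`. -/
structure IsAdmissible (N n k : ℕ) (lam : Fin N → ℕ) : Prop where
  antitone : Antitone lam
  le : ∀ i, k ≤ lam i
  gap : ∀ i j : Fin N, (j : ℕ) = i + n → lam j + k ≤ lam i

/-- `∑ᵢ (lam_i - k)(lam_i - k + N + 1 - 2 i)`; the index `i : Fin N` stands for `i + 1`. -/
def energy (N k : ℕ) (lam : Fin N → ℕ) : ℤ :=
  ∑ i : Fin N, ((lam i : ℤ) - k) * ((lam i : ℤ) - k + N + 1 - 2 * ((i : ℤ) + 1))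

end ChernSimonsMatrix

end

/-! Write C^i_j = -F^j_i for the column polarizations and L^i_j for the part of the E^r_s that acts
on the rows of X. In the Fischer inner product multiplication by a variable is adjoint to
differentiation, so these families are closed under adjoints. Polynomials of bounded degree form
finite-dimensional stable subspaces, so highest weight vectors, complete reducibility and
orthogonality of isotypic pieces come from elementary unitarity arguments.

Duality: by Gaussian elimination a joint highest weight vector is nonzero at some matrix supported
on the diagonal (`exists_evalMat_ne_zero_of_diagonal`). There scaling a row is the same as scaling a
column, so the row and column weights agree (`exists_diagram_of_isHighest`). Hence ℂ[X, A] is the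
orthogonal sum of the components.

Spectrum: the moment map is L^i_j - C^j_i, so membership in H_N(n,k) reads L^i_j f = C^j_i f - kδ f.
Since H_CS is the sum of the L^i_j L^j_i, it acts on H_N(n,k) as (column Casimir) - 2k (Euler
operator) + Nk², a scalar on each component. The moment map preserves the components, so H_N(n,k)
splits along them.

It remains to decide which λ contribute, that is, when the restriction of V_λ from gl_{n+N} to the
gl_N of the rows of X contains V_{λ-k}. If there is a nonzero element, it yields a vector highest
for L and C with weights μ = λ - k and λ. Evaluating this vector at a point with X diagonal, where
any n+1 columns of A are dependent, and following a one-parameter scaling to its limit gives λ_{i+n}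
≤ μ_i (`weight_le_of_column_relation`).

Conversely, for admissible λ a product of minors gives a vector g₁ with these weights. Leading
minors of X alone give g₂ with both weights μ. The pair (g₁, g₂) generates the graph of an
isomorphism up to a twist by k, and evaluation at A = 0, X = 1 is an invariant functional that is
nonzero on g₂. Were there no invariant vectors, unitarity would make g₁ a sum of images of the
moment operators, and this functional would vanish on g₂ (`hilbertPart_ne_bot`). -/

noncomputable section

namespace ChernSimonsMatrix

open scoped InnerProductSpace

/-! ### Subspaces generated under a set of operators. -/

section StableSpan

variable {V ι : Type*} [AddCommGroup V] [Module ℂ V]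

/-- The smallest subspace that contains `H` and is stable under the operators `op a` with `P a`. -/
def stableSpan (op : ι → Module.End ℂ V) (P : ι → Prop) (H : Set V) : Submodule ℂ V :=
  sInf {S | H ⊆ S ∧ ∀ a, P a → ∀ x ∈ S, op a x ∈ S}

variable {op : ι → Module.End ℂ V} {P : ι → Prop} {H : Set V}

theorem subset_stableSpan : H ⊆ stableSpan op P H := by
  intro x hx
  simp only [stableSpan, SetLike.mem_coe, Submodule.mem_sInf]
  exact fun S hS => hS.1 hx

theorem op_mem_stableSpan {a : ι} (ha : P a) {x : V} (hx : x ∈ stableSpan op P H) :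
    op a x ∈ stableSpan op P H := by
  simp only [stableSpan, Submodule.mem_sInf] at hx ⊢
  exact fun S hS => hS.2 a ha x (hx S hS)

theorem stableSpan_le {S : Submodule ℂ V} (hH : H ⊆ S) (hS : ∀ a, P a → ∀ x ∈ S, op a x ∈ S) :
    stableSpan op P H ≤ S :=
  sInf_le ⟨hH, hS⟩

theorem span_range_apply_mem {T : Module.End ℂ V}
    (hT : T ∈ Submodule.span ℂ (Set.range op)) {S : Submodule ℂ V} {x : V}
    (hx : ∀ a, op a x ∈ S) : T x ∈ S := by
  induction hT using Submodule.span_induction with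
  | mem _ h => obtain ⟨a, rfl⟩ := h; exact hx a
  | zero => simp
  | add _ _ _ _ h1 h2 => exact S.add_mem h1 h2
  | smul c _ _ h => exact S.smul_mem c h

/-- If the operators are closed under commutators and those outside `P` map the generators into
`stableSpan op P H`, then this space is stable under all the operators. -/
theorem op_mem_stableSpan_of_bracket
    (hbr : ∀ a b, op a * op b - op b * op a ∈ Submodule.span ℂ (Set.range op))
    (hH : ∀ a, ¬ P a → ∀ x ∈ H, op a x ∈ stableSpan op P H) (a : ι) {x : V}
    (hx : x ∈ stableSpan op P H) : op a x ∈ stableSpan op P H := by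
  set S := stableSpan op P H with hSdef
  -- `Q` contains the generators and is stable under the operators in `P`: move `op c` past `op b`
  -- at the cost of a commutator, which is a combination of the operators. By minimality `S ≤ Q`.
  -- This replaces a PBW argument.
  let Q : Submodule ℂ V := S ⊓ ⨅ b, S.comap (op b)
  have hQ : ∀ y, y ∈ Q ↔ y ∈ S ∧ ∀ b, op b y ∈ S := by
    intro y; simp [Q, Submodule.mem_iInf]
  have hle : S ≤ Q := by
    refine stableSpan_le (fun y hy => (hQ y).2 ⟨subset_stableSpan hy, fun b => ?_⟩) ?_
    · by_cases hb : P b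
      · exact op_mem_stableSpan hb (subset_stableSpan hy)
      · exact hH b hb y hy
    · intro b hb y hy
      obtain ⟨hy1, hy2⟩ := (hQ y).1 hy
      refine (hQ _).2 ⟨hy2 b, fun c => ?_⟩
      have h := span_range_apply_mem (hbr c b) hy2
      have h2 : op b (op c y) ∈ S := op_mem_stableSpan hb (hy2 c)
      have h3 := S.add_mem h h2
      simpa using h3
  exact ((hQ x).1 (hle hx)).2 a

end StableSpan

/-! ### Highest weight theory for families of operators closed under adjoints. -/

section Family

variable {V ι : Type*} [NormedAddCommGroup V] [InnerProductSpace ℂ V]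

/-- A family of operators indexed like matrix units, closed under commutators, whose diagonal
members act on it like those of `gl`, and with `e i j` adjoint to `e j i`. -/
structure IsUnitaryFamily [DecidableEq ι] (e : ι → ι → Module.End ℂ V) : Prop where
  bracket : ∀ i j k l, e i j * e k l - e k l * e i j ∈
    Submodule.span ℂ (Set.range (Function.uncurry e))
  cartan : ∀ k i j, e k k * e i j - e i j * e k k =
    ((if k = i then 1 else 0) - (if k = j then 1 else 0) : ℂ) • e i j
  adjoint : ∀ i j u v, ⟪e i j u, v⟫_ℂ = ⟪u, e j i v⟫_ℂ

/-- `W` is stable under the family `e`. -/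
def StableUnder (e : ι → ι → Module.End ℂ V) (W : Submodule ℂ V) : Prop :=
  ∀ i j, ∀ x ∈ W, e i j x ∈ W

/-- `v` is killed by the raising operators and has weight `w`; `v = 0` is allowed. -/
structure IsHighest [LT ι] (e : ι → ι → Module.End ℂ V) (w : ι → ℂ) (v : V) : Prop where
  raising : ∀ i j, i < j → e i j v = 0
  weight : ∀ i, e i i v = w i • v

/-- The subspace generated by the highest weight vectors of weight `w`. -/
def isotypic [LT ι] (e : ι → ι → Module.End ℂ V) (w : ι → ℂ) : Submodule ℂ V :=
  stableSpan (Function.uncurry e) (fun p => ¬ p.1 < p.2) {v | IsHighest e w v}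

/-- `W` is irreducible under the family `e`. -/
def IrreducibleUnder (e : ι → ι → Module.End ℂ V) (W : Submodule ℂ V) : Prop :=
  StableUnder e W ∧ W ≠ ⊥ ∧ ∀ U, StableUnder e U → U ≤ W → U = ⊥ ∨ U = W

theorem StableUnder.inf {e : ι → ι → Module.End ℂ V} {W U : Submodule ℂ V} (hW : StableUnder e W) (hU : StableUnder e U) :
    StableUnder e (W ⊓ U) :=
  fun i j x hx => ⟨hW i j x hx.1, hU i j x hx.2⟩

theorem exists_irreducibleUnder_le {e : ι → ι → Module.End ℂ V} {W : Submodule ℂ V} [FiniteDimensional ℂ W] (hW0 : W ≠ ⊥)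
    (hW : StableUnder e W) : ∃ U ≤ W, IrreducibleUnder e U := by
  induction hd : Module.finrank ℂ W using Nat.strong_induction_on generalizing W with
  | _ d ih =>
    by_cases h : ∀ U, StableUnder e U → U ≤ W → U = ⊥ ∨ U = W
    · exact ⟨W, le_rfl, hW, hW0, h⟩
    · push Not at h
      obtain ⟨U, hU, hle, hU0, hUW⟩ := h
      have : FiniteDimensional ℂ U := Submodule.finiteDimensional_of_le hle
      obtain ⟨U', hle', hirr⟩ := ih _ (hd ▸ Submodule.finrank_lt_finrank_of_lt
        (lt_of_le_of_ne hle hUW)) hU0 hU rfl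
      exact ⟨U', hle'.trans hle, hirr⟩

variable [LinearOrder ι] {e : ι → ι → Module.End ℂ V}

theorem IsHighest.mem_isotypic {w : ι → ℂ} {v : V} (hv : IsHighest e w v) : v ∈ isotypic e w :=
  subset_stableSpan hv

theorem stableUnder_stableSpan (he : IsUnitaryFamily e) {H : Set V}
    (hH : ∀ i j, i < j → ∀ x ∈ H,
      e i j x ∈ stableSpan (Function.uncurry e) (fun p => ¬ p.1 < p.2) H) :
    StableUnder e (stableSpan (Function.uncurry e) (fun p => ¬ p.1 < p.2) H) := by
  intro i j x hx
  exact op_mem_stableSpan_of_bracket (op := Function.uncurry e) (fun a b => he.bracket _ _ _ _)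
    (fun a ha x hx => hH a.1 a.2 (not_not.1 ha) x hx) (i, j) hx

theorem stableUnder_isotypic (he : IsUnitaryFamily e) (w : ι → ℂ) :
    StableUnder e (isotypic e w) := by
  refine stableUnder_stableSpan he fun i j hij x hx => ?_
  rw [hx.raising i j hij]
  exact Submodule.zero_mem _

/-- An operator commuting with the family preserves its isotypic subspaces. -/
theorem apply_mem_isotypic_of_commute {w : ι → ℂ} {T : Module.End ℂ V}
    (hT : ∀ i j, T * e i j = e i j * T) {x : V} (hx : x ∈ isotypic e w) :
    T x ∈ isotypic e w := by
  have hT' : ∀ i j v, T (e i j v) = e i j (T v) := fun i j v => LinearMap.congr_fun (hT i j) v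
  have : isotypic e w ≤ (isotypic e w).comap T := by
    refine stableSpan_le (fun v hv => ?_) fun a ha v hv => ?_
    · refine IsHighest.mem_isotypic ⟨fun i j hij => ?_, fun i => ?_⟩
      · rw [← hT', IsHighest.raising hv i j hij, map_zero]
      · rw [← hT', IsHighest.weight hv i, map_smul]
    · change T (e a.1 a.2 v) ∈ isotypic e w
      rw [hT']
      exact op_mem_stableSpan (op := Function.uncurry e) (a := a) ha hv
  exact this hx

theorem stableUnder_orthogonal (he : IsUnitaryFamily e) {W : Submodule ℂ V}
    (hW : StableUnder e W) : StableUnder e Wᗮ := by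
  intro i j x hx
  rw [Submodule.mem_orthogonal] at hx ⊢
  intro u hu
  rw [← he.adjoint]
  exact hx _ (hW _ _ u hu)

/-- Diagonal operators are self-adjoint, so their eigenvalues are real. This lets a weight be taken
out of the conjugate-linear slot of the inner product. -/
theorem IsHighest.conj_weight (he : IsUnitaryFamily e) {w : ι → ℂ} {v : V}
    (hv : IsHighest e w v) (hv0 : v ≠ 0) (i : ι) : starRingEnd ℂ (w i) = w i := by
  have h := he.adjoint i i v v
  rw [hv.weight, inner_smul_left, inner_smul_right] at h
  exact mul_right_cancel₀ (inner_self_ne_zero.2 hv0) h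

/-- A highest weight vector orthogonal to the generators is orthogonal to all they generate under
lowering and diagonal operators. -/
theorem IsHighest.inner_stableSpan_eq_zero (he : IsUnitaryFamily e) {w : ι → ℂ} {v : V}
    (hv : IsHighest e w v) {H : Set V} (hH : ∀ x ∈ H, ⟪v, x⟫_ℂ = 0) {x : V}
    (hx : x ∈ stableSpan (Function.uncurry e) (fun p => ¬ p.1 < p.2) H) : ⟪v, x⟫_ℂ = 0 := by
  have : stableSpan (Function.uncurry e) (fun p => ¬ p.1 < p.2) H ≤ (ℂ ∙ v)ᗮ := by
    refine stableSpan_le (fun y hy => Submodule.mem_orthogonal_singleton_iff_inner_right.2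
      (hH y hy)) fun a ha y hy => ?_
    rw [Submodule.mem_orthogonal_singleton_iff_inner_right] at hy ⊢
    change ⟪v, e a.1 a.2 y⟫_ℂ = 0
    rw [← he.adjoint]
    rcases (not_lt.1 ha).lt_or_eq with h | h
    · rw [hv.raising _ _ h, inner_zero_left]
    · rw [h, hv.weight, inner_smul_left, hy, mul_zero]
  exact Submodule.mem_orthogonal_singleton_iff_inner_right.1 (this hx)

theorem IsHighest.inner_eq_zero (he : IsUnitaryFamily e) {w w' : ι → ℂ} {v v' : V}
    (hv : IsHighest e w v) (hv' : IsHighest e w' v') (hw : w ≠ w') : ⟪v, v'⟫_ℂ = 0 := by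
  by_cases hv0 : v = 0
  · rw [hv0, inner_zero_left]
  obtain ⟨i, hi⟩ := Function.ne_iff.1 hw
  have h := he.adjoint i i v v'
  rw [hv.weight, hv'.weight, inner_smul_left, inner_smul_right, hv.conj_weight he hv0] at h
  have h2 : (w i - w' i) * ⟪v, v'⟫_ℂ = 0 := by rw [sub_mul, h, sub_self]
  exact (mul_eq_zero.1 h2).resolve_left (sub_ne_zero.2 hi)

theorem IsHighest.inner_isotypic_eq_zero (he : IsUnitaryFamily e) {w w' : ι → ℂ} {v x : V}
    (hv : IsHighest e w v) (hw : w ≠ w') (hx : x ∈ isotypic e w') : ⟪v, x⟫_ℂ = 0 :=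
  hv.inner_stableSpan_eq_zero he (fun _ hy => hv.inner_eq_zero he hy hw) hx

/-- Highest weight vectors of weight `w` are orthogonal to the other isotypic subspace, whose
orthogonal complement is stable and so contains all that they generate. -/
theorem isotypic_isOrtho (he : IsUnitaryFamily e) {w w' : ι → ℂ} (hw : w ≠ w') :
    isotypic e w ⟂ isotypic e w' := by
  refine stableSpan_le (fun v hv => ?_) fun a ha v hv =>
    stableUnder_orthogonal he (stableUnder_isotypic he w') _ _ v hv
  rw [SetLike.mem_coe, Submodule.mem_orthogonal']
  exact fun x hx => IsHighest.inner_isotypic_eq_zero he hv hw hx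

/-- Commuting operators on a nonzero finite-dimensional complex space have a common
eigenvector. -/
theorem exists_common_eigenvector {V κ : Type*} [AddCommGroup V] [Module ℂ V] [Finite κ]
    (T : κ → Module.End ℂ V) (hT : ∀ i j, T i * T j = T j * T i) (W : Submodule ℂ V)
    [FiniteDimensional ℂ W] (hW0 : W ≠ ⊥) (hW : ∀ i, ∀ x ∈ W, T i x ∈ W) :
    ∃ x ∈ W, x ≠ 0 ∧ ∀ i, ∃ c : ℂ, T i x = c • x := by
  classical
  have := Fintype.ofFinite κ
  have key : ∀ s : Finset κ, ∃ W' ≤ W, W' ≠ ⊥ ∧ (∀ i, ∀ x ∈ W', T i x ∈ W') ∧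
      ∀ i ∈ s, ∃ c : ℂ, ∀ x ∈ W', T i x = c • x := by
    intro s
    induction s using Finset.induction_on with
    | empty => exact ⟨W, le_rfl, hW0, hW, by simp⟩
    | insert i s _ ih =>
      obtain ⟨W', hle, h0, hst, hs⟩ := ih
      have : FiniteDimensional ℂ W' := Submodule.finiteDimensional_of_le hle
      have : Nontrivial W' := Submodule.nontrivial_iff_ne_bot.2 h0
      obtain ⟨c, hc⟩ := Module.End.exists_eigenvalue ((T i).restrict (hst i))
      obtain ⟨y, hy⟩ := hc.exists_hasEigenvector
      have hy1 : T i y = c • (y : V) := congrArg Subtype.val hy.apply_eq_smul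
      refine ⟨W' ⊓ Module.End.eigenspace (T i) c, inf_le_left.trans hle, ?_, ?_, ?_⟩
      · rw [Submodule.ne_bot_iff]
        exact ⟨y, ⟨y.2, Module.End.mem_eigenspace_iff.2 hy1⟩, fun h => hy.2 (Subtype.ext h)⟩
      · rintro j x ⟨hx, hx2⟩
        refine ⟨hst j x hx, Module.End.mem_eigenspace_iff.2 ?_⟩
        rw [SetLike.mem_coe, Module.End.mem_eigenspace_iff] at hx2
        have := LinearMap.congr_fun (hT i j) x
        simp only [Module.End.mul_apply] at this
        rw [this, hx2, map_smul]
      · intro j hj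
        rcases Finset.mem_insert.1 hj with rfl | hj
        · exact ⟨c, fun x hx => Module.End.mem_eigenspace_iff.1 hx.2⟩
        · obtain ⟨d, hd⟩ := hs j hj
          exact ⟨d, fun x hx => hd x hx.1⟩
  obtain ⟨W', hle, h0, -, hs⟩ := key Finset.univ
  obtain ⟨x, hx, hx0⟩ := (Submodule.ne_bot_iff _).1 h0
  refine ⟨x, hle hx, hx0, fun i => ?_⟩
  obtain ⟨c, hc⟩ := hs i (Finset.mem_univ i)
  exact ⟨c, hc x hx⟩

/-- Grade by a combination `D` of the diagonal operators with strictly decreasing real coefficients: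
`e i j` shifts its eigenvalue by `c i - c j`, which is positive when `i < j`. On an eigenspace of
`D` of maximal real part all raising operators vanish, and the commuting diagonal operators have a
common eigenvector there. -/
theorem exists_isHighest [Fintype ι] (he : IsUnitaryFamily e) {W : Submodule ℂ V}
    [FiniteDimensional ℂ W] (hW0 : W ≠ ⊥) (hW : StableUnder e W) :
    ∃ v ∈ W, v ≠ 0 ∧ ∃ w, IsHighest e w v := by
  classical
  -- strictly decreasing real coefficients
  let c : ι → ℝ := fun i => ((Finset.univ.filter (fun j => i < j)).card : ℝ)
  have hc : ∀ i j, i < j → c j < c i := by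
    intro i j hij
    have : Finset.univ.filter (fun k => j < k) ⊂ Finset.univ.filter (fun k => i < k) := by
      rw [Finset.ssubset_iff_of_subset]
      · exact ⟨j, by simp [hij], by simp⟩
      · intro k; simp only [Finset.mem_filter, Finset.mem_univ, true_and]; exact hij.trans
    simpa only [c, Nat.cast_lt] using Finset.card_lt_card this
  let D : Module.End ℂ V := ∑ k, (c k : ℂ) • e k k
  have hD : ∀ i j x, D (e i j x) = e i j (D x) + ((c i - c j : ℝ) : ℂ) • e i j x := by
    intro i j x
    have h1 : ∀ k, e k k (e i j x) = e i j (e k k x) +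
        ((if k = i then 1 else 0) - (if k = j then 1 else 0) : ℂ) • e i j x := by
      intro k
      have := LinearMap.congr_fun (he.cartan k i j) x
      simp only [LinearMap.sub_apply, Module.End.mul_apply, LinearMap.smul_apply] at this
      rw [← this]; abel
    simp only [D, LinearMap.sum_apply, LinearMap.smul_apply, h1, map_sum, map_smul, smul_add,
      Finset.sum_add_distrib]
    congr 1
    simp only [smul_smul, ← Finset.sum_smul, mul_sub, Finset.sum_sub_distrib, mul_ite, mul_one,
      mul_zero, Finset.sum_ite_eq', Finset.mem_univ, if_true]
    push_cast; rfl
  have hDW : ∀ x ∈ W, D x ∈ W := by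
    intro x hx
    simp only [D, LinearMap.sum_apply, LinearMap.smul_apply]
    exact W.sum_mem fun k _ => W.smul_mem _ (hW k k x hx)
  have : Nontrivial W := Submodule.nontrivial_iff_ne_bot.2 hW0
  have hmem : ∀ z : ℂ, Module.End.HasEigenvalue (D.restrict hDW) z ↔ ∃ x ∈ W, x ≠ 0 ∧ D x = z • x := by
    intro z
    constructor
    · intro hz
      obtain ⟨y, hy⟩ := hz.exists_hasEigenvector
      exact ⟨y, y.2, fun h => hy.2 (Subtype.ext h), congrArg Subtype.val hy.apply_eq_smul⟩
    · rintro ⟨x, hx, hx0, hxz⟩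
      refine Module.End.hasEigenvalue_of_hasEigenvector (x := ⟨x, hx⟩)
        ⟨Module.End.mem_eigenspace_iff.2 (Subtype.ext hxz), fun h => hx0 (congrArg Subtype.val h)⟩
  obtain ⟨z, hz, hmax⟩ := Set.exists_max_image _ Complex.re
    (Module.End.finite_hasEigenvalue (D.restrict hDW))
    (Module.End.exists_eigenvalue (D.restrict hDW))
  let U : Submodule ℂ V := W ⊓ Module.End.eigenspace D z
  have hU : ∀ x, x ∈ U ↔ x ∈ W ∧ D x = z • x := fun x => by
    simp [U]
  have hU0 : U ≠ ⊥ := by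
    obtain ⟨x, hx, hx0, hxz⟩ := (hmem z).1 hz
    exact (Submodule.ne_bot_iff _).2 ⟨x, (hU x).2 ⟨hx, hxz⟩, hx0⟩
  have hraise : ∀ i j, i < j → ∀ x ∈ U, e i j x = 0 := by
    intro i j hij x hx
    obtain ⟨hx1, hx2⟩ := (hU x).1 hx
    by_contra hne
    have h1 := hmax (z + ((c i - c j : ℝ) : ℂ)) ((hmem _).2 ⟨e i j x, hW i j x hx1, hne, by
      rw [hD, hx2, map_smul, add_smul]⟩)
    rw [Complex.add_re, Complex.ofReal_re] at h1
    have := hc i j hij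
    linarith
  have : FiniteDimensional ℂ U := Submodule.finiteDimensional_of_le inf_le_left
  obtain ⟨x, hx, hx0, hxc⟩ := exists_common_eigenvector (fun i => e i i)
    (fun i j => by
      have := he.cartan i j j
      rw [sub_self, zero_smul] at this
      exact sub_eq_zero.1 this) U hU0
    (fun i x hx => by
      obtain ⟨hx1, hx2⟩ := (hU x).1 hx
      refine (hU _).2 ⟨hW i i x hx1, ?_⟩
      rw [hD, hx2, map_smul, sub_self, Complex.ofReal_zero, zero_smul, add_zero])
  choose w hw using hxc
  exact ⟨x, ((hU x).1 hx).1, hx0, w, fun i j hij => hraise i j hij x hx, hw⟩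

/-- Complete reducibility. -/
theorem le_sSup_irreducibleUnder (he : IsUnitaryFamily e) {W : Submodule ℂ V}
    [FiniteDimensional ℂ W] (hW : StableUnder e W) :
    W ≤ sSup {U | IrreducibleUnder e U ∧ FiniteDimensional ℂ U} := by
  induction hd : Module.finrank ℂ W using Nat.strong_induction_on generalizing W with
  | _ d ih =>
    by_cases hW0 : W = ⊥
    · rw [hW0]; exact bot_le
    obtain ⟨U, hle, hU⟩ := exists_irreducibleUnder_le hW0 hW
    have : FiniteDimensional ℂ U := Submodule.finiteDimensional_of_le hle
    -- Split off one irreducible. Its orthogonal complement in `W` is stable by unitarity and has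
    -- smaller dimension.
    have hsup := Submodule.sup_orthogonal_inf_of_hasOrthogonalProjection hle
    have : FiniteDimensional ℂ ↥(Uᗮ ⊓ W) := Submodule.finiteDimensional_of_le inf_le_right
    have hlt : Uᗮ ⊓ W < W := by
      refine lt_of_le_of_ne inf_le_right fun h => hU.2.1 ?_
      have h1 : U ≤ Uᗮ := hle.trans (inf_eq_right.1 h)
      rw [eq_bot_iff, ← Submodule.inf_orthogonal_eq_bot U]
      exact le_inf le_rfl h1
    have h2 := ih _ (hd ▸ Submodule.finrank_lt_finrank_of_lt hlt)
      ((stableUnder_orthogonal he hU.1).inf hW) rfl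
    rw [← hsup]
    exact sup_le (le_sSup ⟨hU, inferInstance⟩) h2

end Family

/-! ### Two commuting families as one family over a lexicographic sum. -/

section Sum

variable {V α β : Type*} [NormedAddCommGroup V] [InnerProductSpace ℂ V]

/-- Two families put together as diagonal blocks. -/
def sumFamily (e₁ : α → α → Module.End ℂ V) (e₂ : β → β → Module.End ℂ V) :
    α ⊕ₗ β → α ⊕ₗ β → Module.End ℂ V := fun a b =>
  match ofLex a, ofLex b with
  | .inl i, .inl j => e₁ i j
  | .inr i, .inr j => e₂ i j
  | _, _ => 0

variable {e₁ : α → α → Module.End ℂ V} {e₂ : β → β → Module.End ℂ V}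

@[simp] theorem sumFamily_inl_inl (i j : α) :
    sumFamily e₁ e₂ (Sum.inlₗ i) (Sum.inlₗ j) = e₁ i j := rfl

@[simp] theorem sumFamily_inr_inr (i j : β) :
    sumFamily e₁ e₂ (Sum.inrₗ i) (Sum.inrₗ j) = e₂ i j := rfl

@[simp] theorem sumFamily_inl_inr (i : α) (j : β) :
    sumFamily e₁ e₂ (Sum.inlₗ i) (Sum.inrₗ j) = 0 := rfl

@[simp] theorem sumFamily_inr_inl (i : β) (j : α) :
    sumFamily e₁ e₂ (Sum.inrₗ i) (Sum.inlₗ j) = 0 := rfl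

theorem forall_sumLex {p : α ⊕ₗ β → Prop} :
    (∀ a, p a) ↔ (∀ i, p (Sum.inlₗ i)) ∧ ∀ j, p (Sum.inrₗ j) :=
  ⟨fun h => ⟨fun _ => h _, fun _ => h _⟩, fun h a => match a with
    | Sum.inlₗ i => h.1 i
    | Sum.inrₗ j => h.2 j⟩

theorem stableUnder_sumFamily {W : Submodule ℂ V} :
    StableUnder (sumFamily e₁ e₂) W ↔ StableUnder e₁ W ∧ StableUnder e₂ W := by
  simp only [StableUnder, forall_sumLex]
  simp

/-- The mixed entries are zero, so they add no condition, while commutation of the blocks settles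
the mixed brackets. The theory for one ordered index set then applies to a pair of commuting
actions. -/
theorem isUnitaryFamily_sumFamily [LinearOrder α] [LinearOrder β] (h₁ : IsUnitaryFamily e₁)
    (h₂ : IsUnitaryFamily e₂) (hc : ∀ i j k l, e₁ i j * e₂ k l = e₂ k l * e₁ i j) :
    IsUnitaryFamily (sumFamily e₁ e₂) where
  bracket := by
    have hl : Submodule.span ℂ (Set.range (Function.uncurry e₁)) ≤
        Submodule.span ℂ (Set.range (Function.uncurry (sumFamily e₁ e₂))) := by
      refine Submodule.span_mono ?_
      rintro _ ⟨⟨i, j⟩, rfl⟩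
      exact ⟨(Sum.inlₗ i, Sum.inlₗ j), rfl⟩
    have hr : Submodule.span ℂ (Set.range (Function.uncurry e₂)) ≤
        Submodule.span ℂ (Set.range (Function.uncurry (sumFamily e₁ e₂))) := by
      refine Submodule.span_mono ?_
      rintro _ ⟨⟨i, j⟩, rfl⟩
      exact ⟨(Sum.inrₗ i, Sum.inrₗ j), rfl⟩
    simp only [forall_sumLex]
    simp [hc, fun i j k l => hl (h₁.bracket i j k l), fun i j k l => hr (h₂.bracket i j k l)]
  cartan := by
    have hll : ∀ i j : α, (Sum.inlₗ i : α ⊕ₗ β) = Sum.inlₗ j ↔ i = j := fun i j => by simp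
    have hrr : ∀ i j : β, (Sum.inrₗ i : α ⊕ₗ β) = Sum.inrₗ j ↔ i = j := fun i j => by simp
    have hlr : ∀ (i : α) (j : β), (Sum.inlₗ i : α ⊕ₗ β) ≠ Sum.inrₗ j := fun i j => by simp
    have hrl : ∀ (i : α) (j : β), (Sum.inrₗ j : α ⊕ₗ β) ≠ Sum.inlₗ i := fun i j => by simp
    simp only [forall_sumLex, hll, hrr, hlr, hrl, sumFamily_inl_inl, sumFamily_inr_inr,
      sumFamily_inl_inr, sumFamily_inr_inl, if_false, zero_smul, mul_zero, zero_mul,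
      smul_zero, sub_self, hc]
    simp only [h₁.cartan, h₂.cartan, implies_true, and_self]
  adjoint := by
    simp only [forall_sumLex]
    simp [h₁.adjoint, h₂.adjoint]

theorem isHighest_sumFamily [LinearOrder α] [LinearOrder β] {w : α ⊕ₗ β → ℂ} {v : V} :
    IsHighest (sumFamily e₁ e₂) w v ↔
      IsHighest e₁ (fun i => w (Sum.inlₗ i)) v ∧ IsHighest e₂ (fun i => w (Sum.inrₗ i)) v := by
  constructor
  · intro h
    exact ⟨⟨fun i j hij => h.raising (Sum.inlₗ i) (Sum.inlₗ j) (by simpa using hij),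
      fun i => h.weight (Sum.inlₗ i)⟩, ⟨fun i j hij => h.raising (Sum.inrₗ i) (Sum.inrₗ j)
      (by simpa using hij), fun i => h.weight (Sum.inrₗ i)⟩⟩
  · rintro ⟨h₁, h₂⟩
    refine ⟨?_, forall_sumLex.2 ⟨h₁.weight, h₂.weight⟩⟩
    simp only [forall_sumLex]
    refine ⟨fun i => ⟨fun j hij => h₁.raising i j (by simpa using hij), fun j _ => rfl⟩,
      fun i => ⟨fun j _ => rfl, fun j hij => h₂.raising i j (by simpa using hij)⟩⟩

end Sum

open MvPolynomial

/-! ### The Fischer inner product. -/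

section Fischer

variable {σ : Type*} [Fintype σ]

/-- The product of the factorials of the exponents of a monomial. -/
def multiFactorial (m : σ →₀ ℕ) : ℕ := ∏ i, (m i).factorial

theorem multiFactorial_pos (m : σ →₀ ℕ) : 0 < multiFactorial m :=
  Finset.prod_pos fun _ _ => Nat.factorial_pos _

theorem multiFactorial_add_single (m : σ →₀ ℕ) (p : σ) :
    multiFactorial (m + Finsupp.single p 1) = (m p + 1) * multiFactorial m := by
  classical
  unfold multiFactorial
  rw [← Finset.mul_prod_erase _ _ (Finset.mem_univ p), ← Finset.mul_prod_erase (s := Finset.univ)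
    (f := fun i => (m i).factorial) (a := p) (Finset.mem_univ p), ← mul_assoc]
  congr 1
  · simp [Nat.factorial_succ]
  · refine Finset.prod_congr rfl fun i hi => ?_
    simp [Finsupp.single_eq_of_ne (Finset.ne_of_mem_erase hi)]

/-- The Fischer inner product, for which `X p` is adjoint to `∂ / ∂X p`. -/
def fischer (f g : MvPolynomial σ ℂ) : ℂ :=
  ∑ m ∈ f.support, (multiFactorial m : ℂ) * (starRingEnd ℂ (coeff m f) * coeff m g)

theorem fischer_eq_sum {f g : MvPolynomial σ ℂ} {s : Finset (σ →₀ ℕ)} (hs : f.support ⊆ s) :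
    fischer f g = ∑ m ∈ s, (multiFactorial m : ℂ) * (starRingEnd ℂ (coeff m f) * coeff m g) := by
  refine Finset.sum_subset hs fun m _ hm => ?_
  rw [notMem_support_iff.1 hm]
  simp

/-- The Fischer inner product makes the polynomial ring an inner product space. -/
@[reducible] def fischerCore (σ : Type*) [Fintype σ] : InnerProductSpace.Core ℂ (MvPolynomial σ ℂ) where
  inner := fischer
  conj_inner_symm f g := by
    classical
    change starRingEnd ℂ (fischer g f) = fischer f g
    rw [fischer_eq_sum (Finset.subset_union_left : f.support ⊆ f.support ∪ g.support),
      fischer_eq_sum (Finset.subset_union_right : g.support ⊆ f.support ∪ g.support), map_sum]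
    refine Finset.sum_congr rfl fun m _ => ?_
    simp only [map_mul, map_natCast, Complex.conj_conj]
    ring
  re_inner_nonneg f := by
    unfold fischer
    rw [map_sum]
    refine Finset.sum_nonneg fun m _ => ?_
    rw [← Complex.normSq_eq_conj_mul_self, ← Complex.ofReal_natCast, ← Complex.ofReal_mul]
    exact mul_nonneg (Nat.cast_nonneg _) (Complex.normSq_nonneg _)
  add_left f g h := by
    classical
    change fischer (f + g) h = fischer f h + fischer g h
    rw [fischer_eq_sum (MvPolynomial.support_add : (f + g).support ⊆ f.support ∪ g.support),
      fischer_eq_sum (Finset.subset_union_left : f.support ⊆ f.support ∪ g.support),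
      fischer_eq_sum (Finset.subset_union_right : g.support ⊆ f.support ∪ g.support),
      ← Finset.sum_add_distrib]
    refine Finset.sum_congr rfl fun m _ => ?_
    simp only [coeff_add, map_add]
    ring
  smul_left f g c := by
    change fischer (c • f) g = starRingEnd ℂ c * fischer f g
    rw [fischer_eq_sum (support_smul : (c • f).support ⊆ f.support), fischer, Finset.mul_sum]
    refine Finset.sum_congr rfl fun m _ => ?_
    simp only [coeff_smul, smul_eq_mul, map_mul]
    ring
  definite f hf := by
    change fischer f f = 0 at hf
    have h0 : ∀ m, 0 ≤ (multiFactorial m : ℝ) * Complex.normSq (coeff m f) := fun m =>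
      mul_nonneg (Nat.cast_nonneg _) (Complex.normSq_nonneg _)
    have h1 : fischer f f =
        ((∑ m ∈ f.support, (multiFactorial m : ℝ) * Complex.normSq (coeff m f) : ℝ) : ℂ) := by
      unfold fischer
      push_cast
      refine Finset.sum_congr rfl fun m _ => ?_
      rw [Complex.normSq_eq_conj_mul_self]
    rw [h1, Complex.ofReal_eq_zero, Finset.sum_eq_zero_iff_of_nonneg fun m _ => h0 m] at hf
    ext m
    by_cases hm : m ∈ f.support
    · have := hf m hm
      rw [mul_eq_zero, Complex.normSq_eq_zero] at this
      simpa [(multiFactorial_pos m).ne'] using this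
    · simpa using hm

/-- The norm of the Fischer inner product. -/
scoped instance fischerNormedAddCommGroup : NormedAddCommGroup (MvPolynomial σ ℂ) :=
  (fischerCore σ).toNormedAddCommGroup

scoped instance fischerInnerProductSpace : InnerProductSpace ℂ (MvPolynomial σ ℂ) :=
  InnerProductSpace.ofCore (fischerCore σ).toCore

theorem inner_eq_fischer (f g : MvPolynomial σ ℂ) : ⟪f, g⟫_ℂ = fischer f g := rfl

theorem inner_monomial_left (m : σ →₀ ℕ) (a : ℂ) (g : MvPolynomial σ ℂ) :
    ⟪monomial m a, g⟫_ℂ = (multiFactorial m : ℂ) * (starRingEnd ℂ a * coeff m g) := by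
  classical
  rw [inner_eq_fischer, fischer_eq_sum (support_monomial_subset : (monomial m a).support ⊆ {m}), Finset.sum_singleton,
    coeff_monomial, if_pos rfl]

/-- On a monomial this is `multiFactorial_add_single`: the new factor `m p + 1` in the weight is the
factor produced by differentiation. -/
theorem inner_X_mul_left (p : σ) (f g : MvPolynomial σ ℂ) :
    ⟪X p * f, g⟫_ℂ = ⟪f, pderiv p g⟫_ℂ := by
  induction f using MvPolynomial.induction_on' with
  | monomial m a =>
    rw [mul_comm, X, monomial_mul, mul_one, inner_monomial_left, inner_monomial_left, coeff_pderiv,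
      multiFactorial_add_single]
    push_cast
    ring
  | add f₁ f₂ h₁ h₂ => rw [mul_add, inner_add_left, inner_add_left, h₁, h₂]

theorem inner_pderiv_left (p : σ) (f g : MvPolynomial σ ℂ) :
    ⟪pderiv p f, g⟫_ℂ = ⟪f, X p * g⟫_ℂ := by
  rw [← inner_conj_symm, ← inner_X_mul_left, inner_conj_symm]

end Fischer

/-! ### Commutators and adjoints of the row and column operators. -/

section Operators

variable {N n : ℕ}

/-- The column polarization `∑ᵣ M^r_i ∂ / ∂M^r_j`, the negative of `colGen N n j i`. -/
def colPol (N n : ℕ) (i j : Fin N) : Op N n :=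
  ∑ r, mulEntry N n r i * derivEntry N n r j

theorem colGen_eq (i j : Fin N) : colGen N n i j = -colPol N n j i := rfl

theorem rowGen_apply (r s : Fin (n + N)) (f : Poly N n) :
    rowGen N n r s f = ∑ l, X (r, l) * pderiv (s, l) f := by
  simp [rowGen, mulEntry, derivEntry]

theorem colPol_apply (i j : Fin N) (f : Poly N n) :
    colPol N n i j f = ∑ r, X (r, i) * pderiv (r, j) f := by
  simp [colPol, mulEntry, derivEntry]

/-- `rowGen` as a derivation. -/
def rowDer (N n : ℕ) (r s : Fin (n + N)) : Derivation ℂ (Poly N n) (Poly N n) :=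
  ∑ l, (X (r, l) : Poly N n) • pderiv (s, l)

/-- `colPol` as a derivation. -/
def colDer (N n : ℕ) (i j : Fin N) : Derivation ℂ (Poly N n) (Poly N n) :=
  ∑ r, (X (r, i) : Poly N n) • pderiv (r, j)

theorem derivation_sum_apply {ι : Type*} (s : Finset ι)
    (D : ι → Derivation ℂ (Poly N n) (Poly N n)) (f : Poly N n) :
    (∑ i ∈ s, D i) f = ∑ i ∈ s, D i f := by
  classical
  induction s using Finset.induction_on with
  | empty => simp
  | insert i s hi ih => rw [Finset.sum_insert hi, Finset.sum_insert hi, Derivation.add_apply, ih]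

theorem rowDer_apply (r s : Fin (n + N)) (f : Poly N n) :
    rowDer N n r s f = rowGen N n r s f := by
  rw [rowGen_apply, rowDer, derivation_sum_apply]
  simp

theorem colDer_apply (i j : Fin N) (f : Poly N n) :
    colDer N n i j f = colPol N n i j f := by
  rw [colPol_apply, colDer, derivation_sum_apply]
  simp

theorem rowGen_X (r s a : Fin (n + N)) (b : Fin N) :
    rowGen N n r s (X (a, b)) = if s = a then X (r, b) else 0 := by
  classical
  rw [rowGen_apply]
  simp only [pderiv_X, Pi.single_apply, Prod.mk.injEq]
  by_cases h : s = a
  · subst h; simp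
  · simp [h, Ne.symm h]

theorem colPol_X (i j : Fin N) (a : Fin (n + N)) (b : Fin N) :
    colPol N n i j (X (a, b)) = if j = b then X (a, i) else 0 := by
  classical
  rw [colPol_apply]
  simp only [pderiv_X, Pi.single_apply, Prod.mk.injEq]
  by_cases h : j = b
  · subst h; simp
  · simp [h, Ne.symm h]

/-- A commutator of derivations is a derivation, so the relation need only be checked on the
variables. The next two commutator computations work the same way. -/
theorem rowGen_commutator (r s t u : Fin (n + N)) :
    rowGen N n r s * rowGen N n t u - rowGen N n t u * rowGen N n r s =
      (if s = t then rowGen N n r u else 0) - (if u = r then rowGen N n t s else 0) := by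
  have h : ⁅rowDer N n r s, rowDer N n t u⁆ =
      (if s = t then rowDer N n r u else 0) - (if u = r then rowDer N n t s else 0) := by
    refine derivation_ext fun ⟨a, b⟩ => ?_
    rw [Derivation.commutator_apply, Derivation.sub_apply]
    split_ifs with h1 h2 h2 <;> simp only [rowDer_apply, rowGen_X, Derivation.zero_apply] <;>
      split_ifs <;> simp_all [rowGen_X]
  refine LinearMap.ext fun f => ?_
  have := congrArg (fun D => D f) h
  simp only [Derivation.commutator_apply, Derivation.sub_apply, rowDer_apply] at this
  simp only [LinearMap.sub_apply, Module.End.mul_apply, this]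
  congr 1 <;> split_ifs <;> simp [rowDer_apply]

theorem colPol_commutator (r s t u : Fin N) :
    colPol N n r s * colPol N n t u - colPol N n t u * colPol N n r s =
      (if s = t then colPol N n r u else 0) - (if u = r then colPol N n t s else 0) := by
  have h : ⁅colDer N n r s, colDer N n t u⁆ =
      (if s = t then colDer N n r u else 0) - (if u = r then colDer N n t s else 0) := by
    refine derivation_ext fun ⟨a, b⟩ => ?_
    rw [Derivation.commutator_apply, Derivation.sub_apply]
    split_ifs with h1 h2 h2 <;> simp only [colDer_apply, colPol_X, Derivation.zero_apply] <;>
      split_ifs <;> simp_all [colPol_X]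
  refine LinearMap.ext fun f => ?_
  have := congrArg (fun D => D f) h
  simp only [Derivation.commutator_apply, Derivation.sub_apply, colDer_apply] at this
  simp only [LinearMap.sub_apply, Module.End.mul_apply, this]
  congr 1 <;> split_ifs <;> simp [colDer_apply]

theorem rowGen_mul_colPol (r s : Fin (n + N)) (i j : Fin N) :
    rowGen N n r s * colPol N n i j = colPol N n i j * rowGen N n r s := by
  have h : ⁅rowDer N n r s, colDer N n i j⁆ = 0 := by
    refine derivation_ext fun ⟨a, b⟩ => ?_
    simp only [Derivation.commutator_apply, colDer_apply, rowDer_apply, colPol_X, rowGen_X]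
    split_ifs <;> simp_all [rowGen_X, colPol_X]
  refine LinearMap.ext fun f => ?_
  have := congrArg (fun D => D f) h
  simp only [Derivation.commutator_apply, rowDer_apply, colDer_apply] at this
  exact sub_eq_zero.1 this

theorem inner_rowGen_left (r s : Fin (n + N)) (f g : Poly N n) :
    ⟪rowGen N n r s f, g⟫_ℂ = ⟪f, rowGen N n s r g⟫_ℂ := by
  simp only [rowGen_apply, sum_inner, inner_sum, inner_X_mul_left, inner_pderiv_left]

theorem inner_colPol_left (i j : Fin N) (f g : Poly N n) :
    ⟪colPol N n i j f, g⟫_ℂ = ⟪f, colPol N n j i g⟫_ℂ := by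
  simp only [colPol_apply, sum_inner, inner_sum, inner_X_mul_left, inner_pderiv_left]

/-- The injection `f` serves three uses: the full row family, the columns in a permuted order, and
the rows of X inside all rows. -/
theorem gl_isUnitaryFamily {ι κ V : Type*} [NormedAddCommGroup V] [InnerProductSpace ℂ V]
    [DecidableEq ι] [DecidableEq κ] {e : ι → ι → Module.End ℂ V}
    (hbr : ∀ r s t u, e r s * e t u - e t u * e r s =
      (if s = t then e r u else 0) - (if u = r then e t s else 0))
    (hadj : ∀ i j u v, ⟪e i j u, v⟫_ℂ = ⟪u, e j i v⟫_ℂ) (f : κ → ι)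
    (hf : Function.Injective f) : IsUnitaryFamily (fun i j => e (f i) (f j)) where
  bracket i j k l := by
    rw [hbr]
    have h : ∀ a b, e (f a) (f b) ∈
        Submodule.span ℂ (Set.range (Function.uncurry fun i j => e (f i) (f j))) :=
      fun a b => Submodule.subset_span ⟨(a, b), rfl⟩
    refine Submodule.sub_mem _ ?_ ?_ <;> split_ifs <;> first | exact h _ _ | exact zero_mem _
  cartan k i j := by
    rw [hbr]
    simp only [hf.eq_iff]
    rw [sub_smul]
    congr 1
    · split_ifs with h
      · rw [h, one_smul]
      · rw [zero_smul]
    · by_cases h : k = j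
      · subst h; simp
      · simp [h, Ne.symm h]
  adjoint i j u v := hadj _ _ u v

theorem rowGen_isUnitaryFamily : IsUnitaryFamily (rowGen N n) :=
  gl_isUnitaryFamily rowGen_commutator inner_rowGen_left id Function.injective_id

theorem colPol_isUnitaryFamily (τ : Equiv.Perm (Fin N)) :
    IsUnitaryFamily (fun i j => colPol N n (τ i) (τ j)) :=
  gl_isUnitaryFamily colPol_commutator inner_colPol_left τ τ.injective

/-- The generators of the `gl_N`-action on the rows of `X`. -/
def lowerRowGen (N n : ℕ) (i j : Fin N) : Op N n := rowGen N n (Fin.natAdd n i) (Fin.natAdd n j)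

theorem lowerRowGen_isUnitaryFamily : IsUnitaryFamily (lowerRowGen N n) :=
  gl_isUnitaryFamily rowGen_commutator inner_rowGen_left (Fin.natAdd n)
    (Fin.natAdd_injective _ _)

/-- Makes the spaces of polynomials of bounded degree stable, which is the source of finite
dimensionality throughout. -/
theorem X_mul_pderiv_mem_restrictTotalDegree {σ : Type*} (p q : σ) (d : ℕ) {f : MvPolynomial σ ℂ}
    (hf : f ∈ restrictTotalDegree σ ℂ d) : X p * pderiv q f ∈ restrictTotalDegree σ ℂ d := by
  classical
  rw [mem_restrictTotalDegree, totalDegree, Finset.sup_le_iff] at *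
  intro m hm
  rw [mem_support_iff, coeff_X_mul'] at hm
  split_ifs at hm with hp
  · rw [coeff_pderiv] at hm
    have h2 := hf (m - Finsupp.single p 1 + Finsupp.single q 1)
      (mem_support_iff.2 (left_ne_zero_of_mul hm))
    have h3 : m = m - Finsupp.single p 1 + Finsupp.single p 1 :=
      (Finsupp.sub_add_single_one_cancel (Finsupp.mem_support_iff.1 hp)).symm
    rw [h3]
    rw [Finsupp.sum_add_index' (by simp) (by simp), Finsupp.sum_single_index rfl] at h2 ⊢
    exact h2
  · exact absurd rfl hm

theorem rowGen_mem_restrictTotalDegree (r s : Fin (n + N)) (d : ℕ) {f : Poly N n}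
    (hf : f ∈ restrictTotalDegree _ ℂ d) : rowGen N n r s f ∈ restrictTotalDegree _ ℂ d := by
  rw [rowGen_apply]
  exact Submodule.sum_mem _ fun l _ => X_mul_pderiv_mem_restrictTotalDegree _ _ d hf

theorem colPol_mem_restrictTotalDegree (i j : Fin N) (d : ℕ) {f : Poly N n}
    (hf : f ∈ restrictTotalDegree _ ℂ d) : colPol N n i j f ∈ restrictTotalDegree _ ℂ d := by
  rw [colPol_apply]
  exact Submodule.sum_mem _ fun l _ => X_mul_pderiv_mem_restrictTotalDegree _ _ d hf

end Operators

/-! ### Polynomials as functions of a matrix: invariance, homogeneity, elimination. -/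

section Evaluation

theorem hasDerivAt_eval {σ : Type*} [Fintype σ] (f : MvPolynomial σ ℂ) (x y : σ → ℂ) (t : ℂ) :
    HasDerivAt (fun t : ℂ => eval (fun p => x p + t * y p) f)
      (∑ p, y p * eval (fun p => x p + t * y p) (pderiv p f)) t := by
  classical
  induction f using MvPolynomial.induction_on with
  | C a => simpa using hasDerivAt_const t a
  | add f g hf hg =>
    simp only [map_add, mul_add, Finset.sum_add_distrib]
    exact hf.add hg
  | mul_X f i hf =>
    have h1 : HasDerivAt (fun t : ℂ => x i + t * y i) (y i) t := by
      simpa using ((hasDerivAt_id t).mul_const (y i)).const_add (x i)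
    have h2 := hf.mul h1
    simp only [map_mul, eval_X]
    refine h2.congr_deriv ?_
    simp only [Derivation.leibniz, pderiv_X, smul_eq_mul, map_add, map_mul, eval_X, mul_add,
      Finset.sum_add_distrib]
    have h3 : ∑ p, y p * (eval (fun p => x p + t * y p) f *
        eval (fun p => x p + t * y p) ((Pi.single p 1 : σ → MvPolynomial σ ℂ) i)) =
        eval (fun p => x p + t * y p) f * y i := by
      rw [Finset.sum_eq_single i]
      · simp [mul_comm]
      · intro b _ hb; simp [hb.symm]
      · simp
    have h4 : ∑ p, y p * ((x i + t * y i) * eval (fun p => x p + t * y p) (pderiv p f)) =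
        (∑ p, y p * eval (fun p => x p + t * y p) (pderiv p f)) * (x i + t * y i) := by
      rw [Finset.sum_mul]
      exact Finset.sum_congr rfl fun p _ => by ring
    rw [h3, h4]
    ring

/-- Integrates an infinitesimal invariance: the hypothesis says that the derivative along the line
through `x` in direction `y` vanishes. -/
theorem eval_add_eq_of_forall {σ : Type*} [Fintype σ] (f : MvPolynomial σ ℂ) (x y : σ → ℂ)
    (h : ∀ t : ℂ, ∑ p, y p * eval (fun p => x p + t * y p) (pderiv p f) = 0) (t : ℂ) :
    eval (fun p => x p + t * y p) f = eval x f := by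
  have h1 := is_const_of_deriv_eq_zero (f := fun t : ℂ => eval (fun p => x p + t * y p) f)
    (fun t => (hasDerivAt_eval f x y t).differentiableAt)
    (fun t => by rw [(hasDerivAt_eval f x y t).deriv, h t]) t 0
  simpa using h1

variable {N n : ℕ}

/-- Evaluation of a polynomial at a matrix. -/
def evalMat (M : Fin (n + N) → Fin N → ℂ) : Poly N n →+* ℂ := eval fun p => M p.1 p.2

theorem evalMat_colPol (M : Fin (n + N) → Fin N → ℂ) (i j : Fin N) (f : Poly N n) :
    evalMat M (colPol N n i j f) = ∑ r, M r i * evalMat M (pderiv (r, j) f) := by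
  simp [evalMat, colPol_apply]

theorem evalMat_rowGen (M : Fin (n + N) → Fin N → ℂ) (r s : Fin (n + N)) (f : Poly N n) :
    evalMat M (rowGen N n r s f) = ∑ l, M r l * evalMat M (pderiv (s, l) f) := by
  simp [evalMat, rowGen_apply]

theorem evalMat_ext {f g : Poly N n} (h : ∀ M, evalMat M f = evalMat M g) : f = g :=
  MvPolynomial.funext fun x => h fun r j => x (r, j)

theorem exists_evalMat_ne_zero {f : Poly N n} (hf : f ≠ 0) : ∃ M, evalMat M f ≠ 0 := by
  by_contra! h
  exact hf (evalMat_ext fun M => by rw [h, map_zero])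

theorem continuous_evalMat (f : Poly N n) :
    Continuous fun M : Fin (n + N) → Fin N → ℂ => evalMat M f := by
  have h1 : Continuous fun M : Fin (n + N) → Fin N → ℂ =>
      (fun p : Fin (n + N) × Fin N => M p.1 p.2) := by fun_prop
  exact (MvPolynomial.continuous_eval f).comp h1

/-- Adding multiples of column `p` to other columns. -/
theorem evalMat_add_column {f : Poly N n} (p : Fin N) (c : Fin N → ℂ) (hcp : c p = 0)
    (hc : ∀ j, c j ≠ 0 → colPol N n p j f = 0) (M : Fin (n + N) → Fin N → ℂ) :
    evalMat (fun r j => M r j + M r p * c j) f = evalMat M f := by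
  have h := eval_add_eq_of_forall f (fun q => M q.1 q.2) (fun q => M q.1 p * c q.2) (fun t => by
    let M' : Fin (n + N) → Fin N → ℂ := fun r j => M r j + t * (M r p * c j)
    have h1 : ∀ j, c j * evalMat M' (colPol N n p j f) = 0 := by
      intro j
      by_cases hj : c j = 0
      · rw [hj, zero_mul]
      · rw [hc j hj, map_zero, mul_zero]
    rw [Fintype.sum_prod_type_right]
    refine Finset.sum_eq_zero fun j _ => ?_
    refine Eq.trans ?_ (h1 j)
    rw [evalMat_colPol, Finset.mul_sum]
    refine Finset.sum_congr rfl fun r _ => ?_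
    -- Column `p` does not move along the line because `c p = 0`, so the derivative at every time is
    -- a combination of the polarizations at the moving point.
    have : M' r p = M r p := by simp [M', hcp]
    rw [this]
    change M r p * c j * evalMat M' _ = _
    ring) 1
  simpa [evalMat] using h

/-- Adding a combination of other columns to column `q`. -/
theorem evalMat_add_to_column {f : Poly N n} (q : Fin N) (c : Fin N → ℂ) (hcq : c q = 0)
    (hc : ∀ l, c l ≠ 0 → colPol N n l q f = 0) (M : Fin (n + N) → Fin N → ℂ) :
    evalMat (fun r j => M r j + if j = q then ∑ l, c l * M r l else 0) f = evalMat M f := by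
  have h := eval_add_eq_of_forall f (fun x => M x.1 x.2)
    (fun x => if x.2 = q then ∑ l, c l * M x.1 l else 0) (fun t => by
    let M' : Fin (n + N) → Fin N → ℂ :=
      fun r j => M r j + t * (if j = q then ∑ l, c l * M r l else 0)
    have h1 : ∀ l, c l * evalMat M' (colPol N n l q f) = 0 := by
      intro j
      by_cases hj : c j = 0
      · rw [hj, zero_mul]
      · rw [hc j hj, map_zero, mul_zero]
    have h2 : ∑ l, c l * evalMat M' (colPol N n l q f) = 0 :=
      Finset.sum_eq_zero fun l _ => h1 l
    refine Eq.trans ?_ h2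
    rw [Fintype.sum_prod_type]
    simp only [evalMat_colPol, Finset.mul_sum, ite_mul, zero_mul]
    rw [Finset.sum_comm (s := Finset.univ (α := Fin N)) (t := Finset.univ (α := Fin (n + N)))]
    refine Finset.sum_congr rfl fun r _ => ?_
    rw [Finset.sum_ite_eq' Finset.univ q]
    simp only [Finset.mem_univ, if_true, Finset.sum_mul]
    refine Finset.sum_congr rfl fun l _ => ?_
    by_cases hl : l = q
    · simp [hl, hcq]
    · simp only [M', hl, if_false, mul_zero, add_zero, mul_assoc]
      rfl) 1
  simpa [evalMat] using h

/-- Adding multiples of row `p` to other rows. -/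
theorem evalMat_add_row {f : Poly N n} (p : Fin (n + N)) (c : Fin (n + N) → ℂ) (hcp : c p = 0)
    (hc : ∀ r, c r ≠ 0 → rowGen N n p r f = 0) (M : Fin (n + N) → Fin N → ℂ) :
    evalMat (fun r j => M r j + c r * M p j) f = evalMat M f := by
  have h := eval_add_eq_of_forall f (fun q => M q.1 q.2) (fun q => c q.1 * M p q.2) (fun t => by
    let M' : Fin (n + N) → Fin N → ℂ := fun r j => M r j + t * (c r * M p j)
    have h1 : ∀ r, c r * evalMat M' (rowGen N n p r f) = 0 := by
      intro j
      by_cases hj : c j = 0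
      · rw [hj, zero_mul]
      · rw [hc j hj, map_zero, mul_zero]
    rw [Fintype.sum_prod_type]
    refine Finset.sum_eq_zero fun r _ => ?_
    refine Eq.trans ?_ (h1 r)
    rw [evalMat_rowGen, Finset.mul_sum]
    refine Finset.sum_congr rfl fun j _ => ?_
    have : M' p j = M p j := by simp [M', hcp]
    rw [this]
    change c r * M p j * evalMat M' _ = _
    ring) 1
  simpa [evalMat] using h

theorem coeff_X_mul_pderiv {σ : Type*} (p : σ) (f : MvPolynomial σ ℂ) (m : σ →₀ ℕ) :
    coeff m (X p * pderiv p f) = m p * coeff m f := by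
  classical
  rw [coeff_X_mul']
  split_ifs with h
  · have h0 := Finsupp.mem_support_iff.1 h
    have h3 : m - Finsupp.single p 1 + Finsupp.single p 1 = m :=
      Finsupp.sub_add_single_one_cancel h0
    rw [coeff_pderiv, h3, mul_comm, Finsupp.tsub_apply, Finsupp.single_eq_same,
      Nat.cast_sub (Nat.one_le_iff_ne_zero.2 h0)]
    push_cast
    ring
  · rw [Finsupp.notMem_support_iff.1 h]; simp

/-- Eigenvectors of a partial Euler operator are homogeneous in the corresponding variables. -/
theorem exists_degree_of_euler {σ : Type*} [DecidableEq σ] (S : Finset σ)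
    {f : MvPolynomial σ ℂ} (hf : f ≠ 0) {c : ℂ} (h : ∑ p ∈ S, X p * pderiv p f = c • f) :
    ∃ d : ℕ, c = d ∧ ∀ (x : σ → ℂ) (t : ℂ),
      eval (fun p => if p ∈ S then t * x p else x p) f = t ^ d * eval x f := by
  have hc : ∀ m ∈ f.support, ((∑ p ∈ S, m p : ℕ) : ℂ) = c := by
    intro m hm
    have := congrArg (coeff m) h
    simp only [coeff_sum, coeff_X_mul_pderiv, coeff_smul, smul_eq_mul, ← Finset.sum_mul] at this
    push_cast
    exact mul_right_cancel₀ (mem_support_iff.1 hm) this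
  obtain ⟨m₀, hm₀⟩ := support_nonempty.2 hf
  refine ⟨∑ p ∈ S, m₀ p, (hc m₀ hm₀).symm, fun x t => ?_⟩
  rw [eval_eq, eval_eq, Finset.mul_sum]
  refine Finset.sum_congr rfl fun m hm => ?_
  have hd : ∑ p ∈ S, m₀ p = ∑ p ∈ S, m p := by
    exact_mod_cast (hc m₀ hm₀).trans (hc m hm).symm
  have h1 : ∏ i ∈ m.support, (if i ∈ S then t * x i else x i) ^ m i =
      (∏ i ∈ m.support, (if i ∈ S then t else 1) ^ m i) * ∏ i ∈ m.support, x i ^ m i := by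
    rw [← Finset.prod_mul_distrib]
    refine Finset.prod_congr rfl fun i _ => ?_
    split_ifs <;> simp [mul_pow]
  have h2 : ∏ i ∈ m.support, (if i ∈ S then t else 1) ^ m i = t ^ ∑ p ∈ S, m p := by
    rw [← Finset.prod_pow_eq_pow_sum]
    have h3 : ∀ T : Finset σ, ∏ i ∈ T, (if i ∈ S then t else 1) ^ m i =
        ∏ i ∈ T ∩ S, t ^ m i := by
      intro T
      rw [← Finset.filter_mem_eq_inter, Finset.prod_filter]
      refine Finset.prod_congr rfl fun i _ => ?_
      split_ifs <;> simp
    rw [h3, Finset.inter_comm]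
    refine Finset.prod_subset Finset.inter_subset_left fun i hi hi2 => ?_
    have : i ∉ m.support := fun h => hi2 (Finset.mem_inter.2 ⟨hi, h⟩)
    rw [Finsupp.notMem_support_iff.1 this, pow_zero]
  rw [h1, h2, hd]
  ring

theorem exists_degree_of_rowGen {f : Poly N n} (hf : f ≠ 0) {r : Fin (n + N)} {c : ℂ}
    (h : rowGen N n r r f = c • f) :
    ∃ d : ℕ, c = d ∧ ∀ (M : Fin (n + N) → Fin N → ℂ) (t : ℂ),
      evalMat (fun s j => if s = r then t * M s j else M s j) f = t ^ d * evalMat M f := by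
  obtain ⟨d, hd, hs⟩ := exists_degree_of_euler (Finset.univ.map
    ⟨fun l : Fin N => (r, l), Prod.mk_right_injective r⟩) hf (c := c) (by
      rw [Finset.sum_map, ← h, rowGen_apply]; rfl)
  refine ⟨d, hd, fun M t => ?_⟩
  rw [evalMat, evalMat, ← hs]
  congr 2
  funext ⟨s, j⟩
  simp [eq_comm]

theorem exists_degree_of_colPol {f : Poly N n} (hf : f ≠ 0) {i : Fin N} {c : ℂ}
    (h : colPol N n i i f = c • f) :
    ∃ d : ℕ, c = d ∧ ∀ (M : Fin (n + N) → Fin N → ℂ) (t : ℂ),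
      evalMat (fun s j => if j = i then t * M s j else M s j) f = t ^ d * evalMat M f := by
  obtain ⟨d, hd, hs⟩ := exists_degree_of_euler (Finset.univ.map
    ⟨fun r : Fin (n + N) => (r, i), Prod.mk_left_injective i⟩) hf (c := c) (by
      rw [Finset.sum_map, ← h, colPol_apply]; rfl)
  refine ⟨d, hd, fun M t => ?_⟩
  rw [evalMat, evalMat, ← hs]
  congr 2
  funext ⟨s, j⟩
  simp [eq_comm]

/-- Gaussian elimination on the rows in `R` for a polynomial invariant under the elementary
operations it uses. -/
theorem exists_evalMat_ne_zero_of_diagonal {f : Poly N n} (hf : f ≠ 0) (τ : Fin N → Fin (n + N))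
    (hτ : Function.Injective τ) (σ : Equiv.Perm (Fin N)) (R : Set (Fin (n + N)))
    (hτR : ∀ p, τ p ∈ R) (hcol : ∀ p q, p < q → colPol N n (σ p) (σ q) f = 0)
    (hrow : ∀ p, ∀ r ∈ R, (∀ q ≤ p, r ≠ τ q) → rowGen N n (τ p) r f = 0) :
    ∃ M, evalMat M f ≠ 0 ∧ ∀ p, M (τ p) (σ p) ≠ 0 ∧ (∀ q, q ≠ p → M (τ p) (σ q) = 0) ∧
      ∀ r ∈ R, r ≠ τ p → M r (σ p) = 0 := by
  classical
  have key : ∀ m ≤ N, ∃ M, evalMat M f ≠ 0 ∧ ∀ p : Fin N, (p : ℕ) < m → M (τ p) (σ p) ≠ 0 ∧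
      (∀ q, q ≠ p → M (τ p) (σ q) = 0) ∧ ∀ r ∈ R, r ≠ τ p → M r (σ p) = 0 := by
    intro m
    induction m with
    | zero =>
      intro _
      obtain ⟨M, hM⟩ := exists_evalMat_ne_zero hf
      exact ⟨M, hM, fun p hp => absurd hp (Nat.not_lt_zero _)⟩
    | succ m ih =>
      intro hm
      obtain ⟨M, hM, hp'⟩ := ih (Nat.le_of_succ_le hm)
      let p : Fin N := ⟨m, hm⟩
      -- make the pivot nonzero
      obtain ⟨M₀, hM₀, hpiv, hprev⟩ : ∃ M, evalMat M f ≠ 0 ∧ M (τ p) (σ p) ≠ 0 ∧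
          ∀ p' : Fin N, p' < p → M (τ p') (σ p') ≠ 0 ∧
            (∀ q, q ≠ p' → M (τ p') (σ q) = 0) ∧ ∀ r ∈ R, r ≠ τ p' → M r (σ p') = 0 := by
        by_cases h0 : M (τ p) (σ p) = 0
        · let Mt : ℂ → Fin (n + N) → Fin N → ℂ :=
            fun t r j => if r = τ p ∧ j = σ p then t else M r j
          have hMt0 : Mt 0 = M := by
            funext r j
            simp only [Mt]
            split_ifs with h
            · rw [h.1, h.2, h0]
            · rfl
          have hcont : Continuous fun t => evalMat (Mt t) f := by
            refine (continuous_evalMat f).comp ?_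
            refine continuous_pi fun r => continuous_pi fun j => ?_
            by_cases h : r = τ p ∧ j = σ p
            · simp only [Mt, if_pos h]; exact continuous_id
            · simp only [Mt, if_neg h]; exact continuous_const
          -- Being nonzero is an open condition, so a small nonzero value can be put at the pivot.
          -- No exchange of rows is needed; the polynomial need not be invariant under one.
          have hev : ∀ᶠ t in nhds (0 : ℂ), evalMat (Mt t) f ≠ 0 :=
            hcont.continuousAt.eventually_ne (by rw [hMt0]; exact hM)
          obtain ⟨t, ht, ht0⟩ := ((hev.filter_mono nhdsWithin_le_nhds).and
            (self_mem_nhdsWithin : {(0 : ℂ)}ᶜ ∈ nhdsWithin 0 {(0 : ℂ)}ᶜ)).exists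
          refine ⟨Mt t, ht, by simpa [Mt] using ht0, fun p' hlt => ?_⟩
          have hne : p' ≠ p := hlt.ne
          obtain ⟨h1, h2, h3⟩ := hp' p' hlt
          have e1 : τ p' ≠ τ p := hτ.ne hne
          have e2 : σ p' ≠ σ p := σ.injective.ne hne
          refine ⟨by simpa [Mt, e1] using h1, fun q hq => by simpa [Mt, e1] using h2 q hq,
            fun r hr hr2 => by simpa [Mt, e2] using h3 r hr hr2⟩
        · exact ⟨M, hM, h0, fun p' hlt => hp' p' hlt⟩
      -- clear the row of the pivot
      let c : Fin N → ℂ := fun j => if p < σ.symm j then -M₀ (τ p) j / M₀ (τ p) (σ p) else 0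
      let M₁ : Fin (n + N) → Fin N → ℂ := fun r j => M₀ r j + M₀ r (σ p) * c j
      have hM₁ : evalMat M₁ f = evalMat M₀ f := by
        refine evalMat_add_column (σ p) c (by simp [c]) (fun j hj => ?_) M₀
        have : p < σ.symm j := by
          by_contra h
          exact hj (by simp [c, h])
        simpa using hcol p (σ.symm j) this
      have hc : ∀ q, q ≤ p → c (σ q) = 0 := fun q hq => by simp [c, not_lt.2 hq]
      have hpiv₁ : M₁ (τ p) (σ p) = M₀ (τ p) (σ p) := by simp [M₁, hc p le_rfl]
      have hprow₁ : ∀ q, q ≠ p → M₁ (τ p) (σ q) = 0 := by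
        intro q hq
        rcases lt_or_gt_of_ne hq with h | h
        -- To the left of the pivot the row is already zero, since the earlier pivot columns have
        -- been cleared on `R`.
        · simp only [M₁, hc q h.le, mul_zero, add_zero]
          exact (hprev q h).2.2 _ (hτR p) (hτ.ne h.ne')
        · simp only [M₁, c, Equiv.symm_apply_apply, h, if_true]
          field_simp
          ring
      have hprev₁ : ∀ p' : Fin N, p' < p → M₁ (τ p') (σ p') ≠ 0 ∧
            (∀ q, q ≠ p' → M₁ (τ p') (σ q) = 0) ∧ ∀ r ∈ R, r ≠ τ p' → M₁ r (σ p') = 0 := by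
        intro p' hlt
        obtain ⟨h1, h2, h3⟩ := hprev p' hlt
        refine ⟨by simpa [M₁, hc p' hlt.le] using h1, fun q hq => ?_, fun r hr hr2 => by
          simpa [M₁, hc p' hlt.le] using h3 r hr hr2⟩
        simp only [M₁, h2 q hq, h2 p hlt.ne', zero_mul, add_zero]
      -- clear the column of the pivot
      let d : Fin (n + N) → ℂ := fun r =>
        if r ∈ R ∧ ∀ q ≤ p, r ≠ τ q then -M₁ r (σ p) / M₁ (τ p) (σ p) else 0
      let M₂ : Fin (n + N) → Fin N → ℂ := fun r j => M₁ r j + d r * M₁ (τ p) j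
      have hd : ∀ q ≤ p, d (τ q) = 0 := fun q hq => by
        simp only [d]
        rw [if_neg]
        exact fun h => h.2 q hq rfl
      have hM₂ : evalMat M₂ f = evalMat M₁ f := by
        refine evalMat_add_row (τ p) d (hd p le_rfl) (fun r hr => ?_) M₁
        have : r ∈ R ∧ ∀ q ≤ p, r ≠ τ q := by
          by_contra h
          exact hr (by simp only [d, if_neg h])
        exact hrow p r this.1 this.2
      refine ⟨M₂, by rw [hM₂, hM₁]; exact hM₀, fun p' hp'm => ?_⟩
      rcases (Nat.lt_succ_iff.1 hp'm).lt_or_eq with hlt | heq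
      · have hlt : p' < p := hlt
        obtain ⟨h1, h2, h3⟩ := hprev₁ p' hlt
        refine ⟨by simpa [M₂, hd p' hlt.le] using h1, fun q hq => by
          simpa [M₂, hd p' hlt.le] using h2 q hq, fun r hr hr2 => ?_⟩
        simp only [M₂, h3 r hr hr2, hprow₁ p' hlt.ne, mul_zero, add_zero]
      · have : p' = p := Fin.ext heq
        subst this
        refine ⟨by simpa [M₂, hd p le_rfl, hpiv₁] using hpiv, fun q hq => by
          simpa [M₂, hd p le_rfl] using hprow₁ q hq, fun r hr hr2 => ?_⟩
        by_cases hq : ∀ q ≤ p, r ≠ τ q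
        · have hpos : r ∈ R ∧ ∀ q ≤ p, r ≠ τ q := ⟨hr, hq⟩
          simp only [M₂, d, if_pos hpos]
          have := hpiv₁ ▸ hpiv
          field_simp
          ring
        · push Not at hq
          obtain ⟨q, hqp, rfl⟩ := hq
          have hqp' : q < p := lt_of_le_of_ne hqp fun h => hr2 (by rw [h])
          simp only [M₂, hd q hqp, zero_mul, add_zero]
          exact (hprev₁ q hqp').2.1 p hqp'.ne'
  obtain ⟨M, hM, h⟩ := key N le_rfl
  exact ⟨M, hM, fun p => h p p.2⟩

end Evaluation

/-! ### Duality: the decomposition of the polynomial ring into components. -/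

section Components

variable {N n : ℕ}

/-- The weight `(lam_1, …, lam_N, 0, …, 0)` of `gl_{n+N}`. -/
def rowWeight (n : ℕ) (lam : Fin N → ℕ) (r : Fin (n + N)) : ℂ :=
  if h : (r : ℕ) < N then (lam ⟨r, h⟩ : ℂ) else 0

theorem rowWeight_injective : Function.Injective (rowWeight (N := N) n) := by
  intro lam lam' h
  funext i
  have := congrFun h (Fin.castLE (Nat.le_add_left N n) i)
  simpa [rowWeight] using this

theorem colWeight_injective :
    Function.Injective (fun (lam : Fin N → ℕ) (i : Fin N) => (lam i : ℂ)) := by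
  intro lam lam' h
  funext i
  simpa using congrFun h i

/-- For `i < j`, unitarity gives ‖e_{ji} f‖² = (λ_i - λ_j)‖f‖², so the difference cannot be
negative. -/
theorem IsHighest.weight_le {e : Fin N → Fin N → Op N n}
    (hbr : ∀ r s t u, e r s * e t u - e t u * e r s =
      (if s = t then e r u else 0) - (if u = r then e t s else 0))
    (he : IsUnitaryFamily e) {lam : Fin N → ℕ} {f : Poly N n}
    (hf : IsHighest e (fun i => (lam i : ℂ)) f) (hf0 : f ≠ 0) : Antitone lam := by
  refine fun i j hij => ?_
  rcases hij.lt_or_eq with hij | rfl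
  swap
  · exact le_rfl
  have h1 : e i j (e j i f) = ((lam i : ℂ) - lam j) • f := by
    have := LinearMap.congr_fun (hbr i j j i) f
    simp only [if_true, LinearMap.sub_apply, Module.End.mul_apply, hf.raising i j hij, map_zero,
      sub_zero, hf.weight] at this
    rw [this, sub_smul]
  have h2 : ⟪e j i f, e j i f⟫_ℂ = ((lam i : ℂ) - lam j) * ⟪f, f⟫_ℂ := by
    rw [he.adjoint, h1, inner_smul_right]
  rw [inner_self_eq_norm_sq_to_K, inner_self_eq_norm_sq_to_K] at h2
  have h3 : ‖e j i f‖ ^ 2 = ((lam i : ℝ) - lam j) * ‖f‖ ^ 2 := by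
    have h4 : ((‖e j i f‖ ^ 2 : ℝ) : ℂ) = ((((lam i : ℝ) - lam j) * ‖f‖ ^ 2 : ℝ) : ℂ) := by
      push_cast
      exact h2
    exact_mod_cast h4
  have h5 : 0 < ‖f‖ ^ 2 := by positivity
  have h6 : (0 : ℝ) ≤ (lam i : ℝ) - lam j := by
    by_contra h
    have := mul_neg_of_neg_of_pos (not_le.1 h) h5
    have := sq_nonneg ‖e j i f‖
    linarith
  exact_mod_cast sub_nonneg.1 h6

/-- The weights of a joint highest weight vector, for any order of the columns. -/
theorem exists_diagram_of_isHighest (σ : Equiv.Perm (Fin N)) {f : Poly N n} (hf : f ≠ 0)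
    {w : Fin (n + N) → ℂ} {c : Fin N → ℂ} (hw : IsHighest (rowGen N n) w f)
    (hc : IsHighest (fun i j => colPol N n (σ i) (σ j)) c f) :
    ∃ lam : Fin N → ℕ, Antitone lam ∧ w = rowWeight n lam ∧ c = fun i => (lam i : ℂ) := by
  have hτ := Fin.castLE_injective (Nat.le_add_left N n)
  obtain ⟨M, hM, hdiag⟩ := exists_evalMat_ne_zero_of_diagonal hf _ hτ σ Set.univ
    (fun _ => trivial) (fun p q hpq => hc.raising p q hpq) (fun p r _ hr => by
      refine hw.raising _ _ ?_
      by_contra h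
      have h' : (r : ℕ) ≤ p := by simpa using Fin.le_def.1 (not_lt.1 h)
      exact hr ⟨r, h'.trans_lt p.2⟩ (Fin.le_def.2 h') (Fin.ext rfl))
  choose d hd hd' using fun i => exists_degree_of_colPol hf (hc.weight i)
  have hcd : c = fun i => (d i : ℂ) := funext hd
  refine ⟨d, ?_, ?_, hcd⟩
  · subst hcd
    refine hc.weight_le (fun r s t u => ?_) (colPol_isUnitaryFamily σ) hf
    rw [colPol_commutator]
    simp only [σ.injective.eq_iff]
  · funext r
    obtain ⟨b, hb, hb'⟩ := exists_degree_of_rowGen hf (hw.weight r)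
    unfold rowWeight
    split_ifs with hr
    -- The only nonzero entry in row `r` and in its pivot column is the common one, so doubling the
    -- row equals doubling the column. Comparing powers of 2 identifies the degrees.
    · have h1 : evalMat (fun s j => if s = r then 2 * M s j else M s j) f =
          evalMat (fun s j => if j = σ ⟨r, hr⟩ then 2 * M s j else M s j) f := by
        congr 2
        funext s j
        have hrτ : r = Fin.castLE (Nat.le_add_left N n) ⟨r, hr⟩ := Fin.ext rfl
        by_cases h1 : s = r <;> by_cases h2 : j = σ ⟨r, hr⟩
        · rw [if_pos h1, if_pos h2]
        · have := (hdiag ⟨r, hr⟩).2.1 (σ.symm j) (fun h => h2 (by rw [← h]; simp))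
          rw [Equiv.apply_symm_apply, ← hrτ] at this
          rw [if_pos h1, if_neg h2, h1, this, mul_zero]
        · have := (hdiag ⟨r, hr⟩).2.2 s trivial (fun h => h1 (h.trans hrτ.symm))
          rw [if_neg h1, if_pos h2, h2, this, mul_zero]
        · rw [if_neg h1, if_neg h2]
      rw [hb', hd'] at h1
      have h2 : (2 : ℂ) ^ b = 2 ^ d ⟨r, hr⟩ := mul_right_cancel₀ hM h1
      have h3 : (2 : ℕ) ^ b = 2 ^ d ⟨r, hr⟩ := by exact_mod_cast h2
      rw [hb, Nat.pow_right_injective le_rfl h3]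
    -- A row beyond the first `N` is zero at `M`, so doubling it changes nothing and the degree is
    -- 0.
    · have h1 : evalMat (fun s j => if s = r then 2 * M s j else M s j) f = evalMat M f := by
        congr 2
        funext s j
        split_ifs with h
        · have := (hdiag (σ.symm j)).2.2 s trivial (fun h2 => hr (by
            rw [← h, h2]; exact (σ.symm j).2))
          rw [Equiv.apply_symm_apply] at this
          rw [this, mul_zero]
        · rfl
      rw [hb'] at h1
      have h2 : (2 : ℂ) ^ b = 1 := mul_right_cancel₀ hM (by rw [h1, one_mul])
      have h3 : (2 : ℕ) ^ b = 2 ^ 0 := by exact_mod_cast h2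
      rw [hb, Nat.pow_right_injective le_rfl h3]
      simp

/-- Passing to the dual reverses order: `colGen i j` is the negative of `colPol j i`, so raising for
`colGen` is raising for `colPol` with the columns listed backwards. -/
theorem isHighestWeightVector_iff {lam : Fin N → ℕ} {f : Poly N n} :
    IsHighestWeightVector N n lam f ↔ f ≠ 0 ∧ IsHighest (rowGen N n) (rowWeight n lam) f ∧
      IsHighest (fun i j => colPol N n (Fin.revPerm i) (Fin.revPerm j))
        (fun i => (lam i : ℂ)) f := by
  constructor
  · rintro ⟨h0, h1, h2, h3, h4⟩
    refine ⟨h0, ⟨h1, h2⟩, fun i j hij => ?_, fun i => ?_⟩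
    · have := h3 (Fin.rev j) (Fin.rev i) (Fin.rev_lt_rev.2 hij)
      simpa [colGen_eq] using this
    · have := h4 (Fin.rev i)
      simpa [colGen_eq] using this
  · rintro ⟨h0, ⟨h1, h2⟩, ⟨h3, h4⟩⟩
    refine ⟨h0, h1, h2, fun i j hij => ?_, fun i => ?_⟩
    · have := h3 (Fin.rev j) (Fin.rev i) (Fin.rev_lt_rev.2 hij)
      simpa [colGen_eq] using this
    · have := h4 (Fin.rev i)
      simpa [colGen_eq] using this

theorem isStable_iff {W : Submodule ℂ (Poly N n)} :
    IsStable N n W ↔ StableUnder (rowGen N n) W ∧ StableUnder (colPol N n) W := by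
  unfold IsStable StableUnder
  simp only [colGen_eq, LinearMap.neg_apply, Submodule.neg_mem_iff]
  exact and_congr_right fun _ => ⟨fun h i j => h j i, fun h i j => h j i⟩

theorem stableUnder_perm (σ : Equiv.Perm (Fin N)) {W : Submodule ℂ (Poly N n)} :
    StableUnder (fun i j => colPol N n (σ i) (σ j)) W ↔ StableUnder (colPol N n) W :=
  ⟨fun h i j => by simpa using h (σ.symm i) (σ.symm j), fun h i j => h (σ i) (σ j)⟩

theorem isStable_iff_sumFamily (σ : Equiv.Perm (Fin N)) {W : Submodule ℂ (Poly N n)} :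
    IsStable N n W ↔
      StableUnder (sumFamily (rowGen N n) fun i j => colPol N n (σ i) (σ j)) W := by
  rw [stableUnder_sumFamily, stableUnder_perm, isStable_iff]

theorem isIrreducibleSub_iff (σ : Equiv.Perm (Fin N)) {W : Submodule ℂ (Poly N n)} :
    IsIrreducibleSub N n W ↔
      IrreducibleUnder (sumFamily (rowGen N n) fun i j => colPol N n (σ i) (σ j)) W := by
  simp only [IsIrreducibleSub, IrreducibleUnder, isStable_iff_sumFamily σ]

theorem isUnitaryFamily_rowGen_colPol (σ : Equiv.Perm (Fin N)) :
    IsUnitaryFamily (sumFamily (rowGen N n) fun i j => colPol N n (σ i) (σ j)) :=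
  isUnitaryFamily_sumFamily rowGen_isUnitaryFamily (colPol_isUnitaryFamily σ)
    fun i j k l => rowGen_mul_colPol i j (σ k) (σ l)

theorem isStable_restrictTotalDegree (d : ℕ) : IsStable N n (restrictTotalDegree _ ℂ d) :=
  isStable_iff.2 ⟨fun i j _ hx => rowGen_mem_restrictTotalDegree i j d hx,
    fun i j _ hx => colPol_mem_restrictTotalDegree i j d hx⟩

theorem mem_restrictTotalDegree_totalDegree (f : Poly N n) :
    f ∈ restrictTotalDegree _ ℂ f.totalDegree :=
  (mem_restrictTotalDegree _ _ _).2 le_rfl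

theorem IsIrreducibleSub.le_of_mem {W U : Submodule ℂ (Poly N n)} (hW : IsIrreducibleSub N n W)
    (hU : IsStable N n U) {f : Poly N n} (hfW : f ∈ W) (hfU : f ∈ U) (hf : f ≠ 0) : W ≤ U := by
  have hst : IsStable N n (W ⊓ U) :=
    ⟨fun r s x hx => ⟨hW.1.1 r s x hx.1, hU.1 r s x hx.2⟩,
      fun r s x hx => ⟨hW.1.2 r s x hx.1, hU.2 r s x hx.2⟩⟩
  rcases hW.2.2 _ hst inf_le_left with h | h
  · exact absurd ((Submodule.mem_bot ℂ).1 (h ▸ (⟨hfW, hfU⟩ : f ∈ W ⊓ U))) hf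
  · exact inf_eq_left.1 h

theorem IsIrreducibleSub.finiteDimensional {W : Submodule ℂ (Poly N n)}
    (hW : IsIrreducibleSub N n W) : FiniteDimensional ℂ W := by
  obtain ⟨f, hf, hf0⟩ := (Submodule.ne_bot_iff _).1 hW.2.1
  exact Submodule.finiteDimensional_of_le (hW.le_of_mem
    (isStable_restrictTotalDegree f.totalDegree) hf (mem_restrictTotalDegree_totalDegree f) hf0)

theorem IsIrreducibleSub.exists_isHighest (σ : Equiv.Perm (Fin N)) {W : Submodule ℂ (Poly N n)}
    (hW : IsIrreducibleSub N n W) : ∃ f ∈ W, f ≠ 0 ∧ ∃ lam : Fin N → ℕ, Antitone lam ∧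
      IsHighest (rowGen N n) (rowWeight n lam) f ∧
      IsHighest (fun i j => colPol N n (σ i) (σ j)) (fun i => (lam i : ℂ)) f := by
  have := hW.finiteDimensional
  obtain ⟨f, hf, hf0, w, hw⟩ := ChernSimonsMatrix.exists_isHighest
    (isUnitaryFamily_rowGen_colPol σ) hW.2.1 ((isStable_iff_sumFamily σ).1 hW.1)
  obtain ⟨h1, h2⟩ := isHighest_sumFamily.1 hw
  obtain ⟨lam, hlam, e1, e2⟩ := exists_diagram_of_isHighest σ hf0 h1 h2
  exact ⟨f, hf, hf0, lam, hlam, e1 ▸ h1, e2 ▸ h2⟩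

theorem isStable_isotypic_rowGen (w : Fin (n + N) → ℂ) :
    IsStable N n (isotypic (rowGen N n) w) :=
  isStable_iff.2 ⟨stableUnder_isotypic rowGen_isUnitaryFamily w, fun i j _ hx =>
    apply_mem_isotypic_of_commute (fun r s => (rowGen_mul_colPol r s i j).symm) hx⟩

theorem isStable_isotypic_colPol (w : Fin N → ℂ) :
    IsStable N n (isotypic (colPol N n) w) :=
  isStable_iff.2 ⟨fun i j _ hx => apply_mem_isotypic_of_commute
    (fun r s => rowGen_mul_colPol i j r s) hx,
    stableUnder_isotypic (colPol_isUnitaryFamily (Equiv.refl _)) w⟩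

/-- An irreducible lies in a single isotypic subspace of the rows. The row weight thus links highest
weight vectors taken for different orders of the columns. -/
theorem IsIrreducibleSub.rowWeight_eq {W : Submodule ℂ (Poly N n)} (hW : IsIrreducibleSub N n W)
    {f g : Poly N n} (hf : f ∈ W) (hf0 : f ≠ 0) (hg : g ∈ W) (hg0 : g ≠ 0)
    {w w' : Fin (n + N) → ℂ} (hfw : IsHighest (rowGen N n) w f)
    (hgw : IsHighest (rowGen N n) w' g) : w = w' := by
  by_contra hne
  have h1 := hW.le_of_mem (isStable_isotypic_rowGen w) hf hfw.mem_isotypic hf0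
  exact hg0 (inner_self_eq_zero.1 (hgw.inner_isotypic_eq_zero rowGen_isUnitaryFamily
    (Ne.symm hne) (h1 hg)))

/-- The components in terms of highest weight vectors for the natural order of the columns. -/
theorem component_le_isotypic_colPol (lam : Fin N → ℕ) :
    component N n lam ≤ isotypic (colPol N n) (fun i => (lam i : ℂ)) := by
  refine sSup_le ?_
  rintro W ⟨hW, f, hf, hfl⟩
  obtain ⟨hf0, hf1, -⟩ := isHighestWeightVector_iff.1 hfl
  obtain ⟨g, hg, hg0, lam', -, hg1, hg2⟩ := hW.exists_isHighest (Equiv.refl _)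
  obtain rfl : lam = lam' := rowWeight_injective (hW.rowWeight_eq hf hf0 hg hg0 hf1 hg1)
  exact hW.le_of_mem (isStable_isotypic_colPol _) hg (IsHighest.mem_isotypic hg2) hg0

theorem component_isOrtho {lam lam' : Fin N → ℕ} (h : lam ≠ lam') :
    component N n lam ⟂ component N n lam' :=
  (isotypic_isOrtho (colPol_isUnitaryFamily (Equiv.refl _)) (colWeight_injective.ne h)).mono
    (component_le_isotypic_colPol lam) (component_le_isotypic_colPol lam')

theorem isStable_component (lam : Fin N → ℕ) : IsStable N n (component N n lam) := by
  have key : ∀ T : Op N n, (∀ W, IsStable N n W → W ≤ W.comap T) →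
      component N n lam ≤ (component N n lam).comap T := by
    intro T hT
    refine sSup_le fun W hW => (hT W hW.1.1).trans (Submodule.comap_mono (le_sSup hW))
  exact ⟨fun r s f hf => key _ (fun W hW => hW.1 r s) hf,
    fun r s f hf => key _ (fun W hW => hW.2 r s) hf⟩

/-- A polynomial lies in a bounded-degree stable space, which is contained in a sum of irreducibles.
Each of these has a joint highest weight vector, and its weight comes from a diagram. -/
theorem iSup_component_eq_top :
    ⨆ lam : {lam : Fin N → ℕ // Antitone lam}, component N n lam = ⊤ := by
  refine eq_top_iff.2 fun f _ => ?_
  have h1 := le_sSup_irreducibleUnder (isUnitaryFamily_rowGen_colPol Fin.revPerm)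
    ((isStable_iff_sumFamily Fin.revPerm).1 (isStable_restrictTotalDegree (N := N) (n := n)
      f.totalDegree)) (mem_restrictTotalDegree_totalDegree f)
  refine (sSup_le ?_ : _ ≤ ⨆ lam : {lam : Fin N → ℕ // Antitone lam}, component N n lam) h1
  rintro W ⟨hW, -⟩
  have hW' := (isIrreducibleSub_iff Fin.revPerm).2 hW
  obtain ⟨g, hg, hg0, lam, hlam, hg1, hg2⟩ := hW'.exists_isHighest Fin.revPerm
  refine le_trans ?_ (le_iSup _ ⟨lam, hlam⟩)
  exact le_sSup ⟨hW', g, hg, isHighestWeightVector_iff.2 ⟨hg0, hg1, hg2⟩⟩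

section General

variable {V ι κ : Type*} [NormedAddCommGroup V] [InnerProductSpace ℂ V]

/-- A common kernel splits along an orthogonal decomposition preserved by the operators. -/
theorem mem_iSup_inf_ker {K : ι → Submodule ℂ V} (hK : Pairwise fun i j => K i ⟂ K j)
    {T : κ → Module.End ℂ V} (hT : ∀ a i, ∀ x ∈ K i, T a x ∈ K i) {f : V} (hfK : f ∈ ⨆ i, K i)
    (hf : ∀ a, T a f = 0) : f ∈ ⨆ i, K i ⊓ ⨅ a, LinearMap.ker (T a) := by
  obtain ⟨g, hg, rfl⟩ := (Submodule.mem_iSup_iff_exists_finsupp _ _).1 hfK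
  refine Submodule.sum_mem _ fun i hi => Submodule.mem_iSup_of_mem i
    ⟨hg i, (Submodule.mem_iInf _).2 fun a => LinearMap.mem_ker.2 ?_⟩
  have h1 : ∑ j ∈ g.support, T a (g j) = 0 := by
    have := hf a
    rwa [Finsupp.sum, map_sum] at this
  -- The images stay in mutually orthogonal summands, so pairing with one image isolates its norm.
  have h2 : ⟪T a (g i), ∑ j ∈ g.support, T a (g j)⟫_ℂ = ⟪T a (g i), T a (g i)⟫_ℂ := by
    rw [inner_sum]
    refine Finset.sum_eq_single_of_mem i hi fun j _ hji => ?_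
    exact Submodule.IsOrtho.inner_eq (hK hji.symm) (hT a i _ (hg i)) (hT a j _ (hg j))
  rw [h1, inner_zero_right] at h2
  exact inner_self_eq_zero.1 h2.symm

end General

/-- A highest weight vector for the columns lies in the component of its weight. -/
theorem mem_component_of_isHighest {lam : Fin N → ℕ} (hlam : Antitone lam) {f : Poly N n}
    (hf : IsHighest (colPol N n) (fun i => (lam i : ℂ)) f) : f ∈ component N n lam := by
  have hmem : f ∈ ⨆ lam : {lam : Fin N → ℕ // Antitone lam}, component N n lam := by
    rw [iSup_component_eq_top]; trivial
  obtain ⟨g, hg, hgf⟩ := (Submodule.mem_iSup_iff_exists_finsupp _ _).1 hmem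
  have h0 : ∀ ν : {lam : Fin N → ℕ // Antitone lam}, ν ≠ ⟨lam, hlam⟩ → g ν = 0 := by
    intro ν hν
    have hne : lam ≠ ν := fun h => hν (Subtype.ext h.symm)
    have h1 : ⟪f, g ν⟫_ℂ = 0 := hf.inner_isotypic_eq_zero (colPol_isUnitaryFamily (Equiv.refl _))
      (colWeight_injective.ne hne) (component_le_isotypic_colPol _ (hg ν))
    by_contra hgν
    -- `g ν` is the orthogonal projection of `f` to the component of `ν`, so its norm squared is ⟪f,
    -- g ν⟫, which is 0 by the weight.
    have h2 : ⟪f, g ν⟫_ℂ = ⟪g ν, g ν⟫_ℂ := by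
      rw [← hgf, Finsupp.sum, sum_inner]
      refine Finset.sum_eq_single_of_mem ν (Finsupp.mem_support_iff.2 hgν) fun j _ hj => ?_
      exact Submodule.IsOrtho.inner_eq (component_isOrtho fun h => hj (Subtype.ext h))
        (hg j) (hg ν)
    exact hgν (inner_self_eq_zero.1 (h2.symm.trans h1))
  rw [← hgf, Finsupp.sum]
  refine Submodule.sum_mem _ fun ν _ => ?_
  by_cases hν : ν = ⟨lam, hlam⟩
  · have h2 : (ν : Fin N → ℕ) = lam := congrArg Subtype.val hν
    exact h2 ▸ hg ν
  · rw [h0 ν hν]; exact zero_mem _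

end Components

/-! ### Necessity of admissibility. -/

section Admissible

variable {N n k : ℕ}

/-- The second and third sums of the moment map run over the rows of X and of A, and together form a
polarization over all rows. -/
theorem momentMap_eq (i j : Fin N) :
    momentMap N n i j = lowerRowGen N n i j - colPol N n j i := by
  unfold momentMap lowerRowGen rowGen colPol
  rw [Fin.sum_univ_add]
  simp only [opX, opY, opA, opB, Matrix.of_apply]
  abel

theorem mem_hilbert_iff {f : Poly N n} : f ∈ hilbert N n k ↔
    ∀ i j, lowerRowGen N n i j f = colPol N n j i f - (if i = j then (k : ℂ) else 0) • f := by
  simp only [hilbert, Submodule.mem_iInf, LinearMap.mem_ker]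
  refine forall₂_congr fun i j => ?_
  rw [momentMap_eq, LinearMap.add_apply, LinearMap.sub_apply]
  have : (if i = j then (k : ℂ) • (1 : Op N n) else 0) f = (if i = j then (k : ℂ) else 0) • f := by
    split_ifs <;> simp
  rw [this, eq_sub_iff_add_eq, sub_add_eq_add_sub, sub_eq_zero]

theorem lowerRowGen_mul_colPol (i j a b : Fin N) :
    lowerRowGen N n i j * colPol N n a b = colPol N n a b * lowerRowGen N n i j :=
  rowGen_mul_colPol _ _ _ _

theorem isUnitaryFamily_lowerRowGen_colPol :
    IsUnitaryFamily (sumFamily (lowerRowGen N n) (colPol N n)) :=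
  isUnitaryFamily_sumFamily lowerRowGen_isUnitaryFamily (colPol_isUnitaryFamily (Equiv.refl _))
    lowerRowGen_mul_colPol

theorem IsStable.stableUnder_lowerRowGen_colPol {W : Submodule ℂ (Poly N n)}
    (hW : IsStable N n W) : StableUnder (sumFamily (lowerRowGen N n) (colPol N n)) W :=
  stableUnder_sumFamily.2 ⟨fun _ _ => (isStable_iff.1 hW).1 _ _, (isStable_iff.1 hW).2⟩

/-- A nonzero element of `hilbertPart` yields a highest weight vector for the rows of `X` and the
columns, with the two weights differing by `k`. -/
theorem exists_isHighest_of_mem_hilbertPart {lam : Fin N → ℕ} {h : Poly N n}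
    (hh : h ∈ hilbertPart N n k lam) (h0 : h ≠ 0) :
    ∃ v : Poly N n, v ≠ 0 ∧ ∃ μ : Fin N → ℕ, IsHighest (colPol N n) (fun i => (lam i : ℂ)) v ∧
      IsHighest (lowerRowGen N n) (fun i => (μ i : ℂ)) v ∧ ∀ i, lam i = μ i + k := by
  obtain ⟨hcomp, hhil⟩ := hh
  have hhil' := mem_hilbert_iff.1 hhil
  have he := isUnitaryFamily_lowerRowGen_colPol (N := N) (n := n)
  set e := sumFamily (lowerRowGen N n) (colPol N n) with he_def
  set S := stableSpan (Function.uncurry e) (fun p => ¬ p.1 < p.2) {h} with hS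
  have hmem : h ∈ S := subset_stableSpan rfl
  have hlow : ∀ a b, ¬ a < b → e a b h ∈ S := fun a b hab =>
    op_mem_stableSpan (op := Function.uncurry e) (a := (a, b)) hab hmem
  -- On `h` a raising operator of one factor equals a lowering operator of the other, by the
  -- equations of `hilbert`; the constant `k` enters only on the diagonal. So lowering and diagonal
  -- operators alone already generate everything from `h`.
  have hstab : StableUnder e S := by
    refine stableUnder_stableSpan he ?_
    simp only [Set.mem_singleton_iff, forall_eq]
    simp only [forall_sumLex]
    refine ⟨fun i => ⟨fun j hij => ?_, fun j _ => by simp [e]⟩,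
      fun i => ⟨fun j _ => by simp [e], fun j hij => ?_⟩⟩
    · have hij' : i < j := by simpa using hij
      have h1 := hhil' i j
      rw [if_neg hij'.ne, zero_smul, sub_zero] at h1
      have h2 := hlow (Sum.inrₗ j) (Sum.inrₗ i) (by simpa using hij'.le)
      rw [he_def, sumFamily_inr_inr] at h2
      rw [he_def, sumFamily_inl_inl, h1]
      exact h2
    · have hij' : i < j := by simpa using hij
      have h1 := hhil' j i
      rw [if_neg hij'.ne', zero_smul, sub_zero] at h1
      have h2 := hlow (Sum.inlₗ j) (Sum.inlₗ i) (by simpa using hij'.le)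
      rw [he_def, sumFamily_inl_inl, h1] at h2
      rw [he_def, sumFamily_inr_inr]
      exact h2
  have hle : ∀ W : Submodule ℂ (Poly N n), IsStable N n W → h ∈ W → S ≤ W := fun W hW hhW =>
    stableSpan_le (by simpa using hhW) fun a _ x hx =>
      hW.stableUnder_lowerRowGen_colPol a.1 a.2 x hx
  have : FiniteDimensional ℂ S := Submodule.finiteDimensional_of_le
    (hle _ (isStable_restrictTotalDegree h.totalDegree) (mem_restrictTotalDegree_totalDegree h))
  obtain ⟨v, hvS, hv0, w, hw⟩ := exists_isHighest he
    ((Submodule.ne_bot_iff _).2 ⟨h, hmem, h0⟩) hstab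
  -- Otherwise the highest weight vector `v` would be orthogonal to all that `h` generates under
  -- lowering and diagonal operators, hence to itself.
  have hvh : ⟪v, h⟫_ℂ ≠ 0 := fun hvh => hv0 (inner_self_eq_zero.1
    (hw.inner_stableSpan_eq_zero he (H := {h}) (by simpa using hvh) hvS))
  obtain ⟨h1, h2⟩ := isHighest_sumFamily.1 hw
  have hcol : (fun i => w (Sum.inrₗ i)) = fun i => (lam i : ℂ) := by
    by_contra hne
    exact hv0 (inner_self_eq_zero.1 (h2.inner_isotypic_eq_zero
      (colPol_isUnitaryFamily (Equiv.refl _)) hne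
      (component_le_isotypic_colPol lam (hle _ (isStable_component lam) hcomp hvS))))
  rw [hcol] at h2
  -- Move the diagonal row operator onto `h`, replace it by the column operator minus `k`, and move
  -- that back to `v`. Dividing by ⟪v, h⟫ compares the weights.
  have hrow : ∀ i, w (Sum.inlₗ i) = (lam i : ℂ) - k := by
    intro i
    have h3 := inner_rowGen_left (Fin.natAdd n i) (Fin.natAdd n i) v h
    have h4 := hhil' i i
    rw [if_pos rfl] at h4
    have h5 := h1.weight i
    unfold lowerRowGen at h4 h5
    rw [h4, h5, inner_smul_left, h1.conj_weight lowerRowGen_isUnitaryFamily hv0 i, inner_sub_right,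
      inner_smul_right, ← inner_colPol_left, h2.weight, inner_smul_left, Complex.conj_natCast,
      ← sub_mul] at h3
    exact mul_right_cancel₀ hvh h3
  choose μ hμ _ using fun i => exists_degree_of_rowGen hv0 (h1.weight i)
  refine ⟨v, hv0, μ, h2, ?_, fun i => ?_⟩
  · have : (fun i => w (Sum.inlₗ i)) = fun i => (μ i : ℂ) := funext hμ
    rwa [this] at h1
  · have h3 := (hμ i).symm.trans (hrow i)
    have h4 : ((μ i + k : ℕ) : ℂ) = (lam i : ℕ) := by push_cast; rw [h3]; ring
    exact_mod_cast h4.symm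

/-- A relation between `n + 1` consecutive columns of an `n`-rowed matrix. -/
theorem exists_column_relation (M : Fin (n + N) → Fin N → ℂ) (i j : Fin N)
    (hij : (j : ℕ) = i + n) : ∃ c : Fin N → ℂ, (∃ l, c l ≠ 0) ∧
      (∀ l, c l ≠ 0 → i ≤ l ∧ l ≤ j) ∧ ∀ a : Fin n, ∑ l, c l * M (Fin.castAdd N a) l = 0 := by
  classical
  let L : ({l // l ∈ Finset.Icc i j} → ℂ) →ₗ[ℂ] (Fin n → ℂ) :=
    Matrix.toLin' (Matrix.of fun a l => M (Fin.castAdd N a) l.1)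
  have hker : LinearMap.ker L ≠ ⊥ := by
    refine LinearMap.ker_ne_bot_of_finrank_lt ?_
    rw [Module.finrank_fin_fun, Module.finrank_fintype_fun_eq_card, Fintype.card_coe, Fin.card_Icc,
      hij]
    omega
  obtain ⟨w, hw, hw0⟩ := (Submodule.ne_bot_iff _).1 hker
  obtain ⟨l₀, hl₀⟩ := Function.ne_iff.1 hw0
  refine ⟨fun l => if h : l ∈ Finset.Icc i j then w ⟨l, h⟩ else 0, ⟨l₀, ?_⟩, fun l hl => ?_,
    fun a => ?_⟩
  · simpa using hl₀
  · by_contra h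
    have : l ∉ Finset.Icc i j := by simpa using h
    exact hl (dif_neg this)
  · have h1 := congrFun (LinearMap.mem_ker.1 hw) a
    simp only [L, Matrix.toLin'_apply, Matrix.mulVec, dotProduct, Matrix.of_apply,
      Pi.zero_apply] at h1
    refine Eq.trans ?_ h1
    rw [← Finset.sum_subset (Finset.subset_univ (Finset.Icc i j)),
      ← Finset.sum_coe_sort (Finset.Icc i j)]
    · refine Finset.sum_congr rfl fun l _ => ?_
      beta_reduce
      rw [dif_pos l.2, mul_comm]
    · intro l _ hl
      beta_reduce
      rw [dif_neg hl, zero_mul]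

/-- The interlacing part of the branching rule: with `p < q`, if column `q` of `A` is a
combination of the columns `p, …, q - 1` involving column `p`, then `lam_q ≤ μ_p`. -/
theorem weight_le_of_column_relation {lam μ : Fin N → ℕ} {v : Poly N n} (hv0 : v ≠ 0)
    (hcol : IsHighest (colPol N n) (fun i => (lam i : ℂ)) v)
    (hrow : IsHighest (lowerRowGen N n) (fun i => (μ i : ℂ)) v)
    {M : Fin (n + N) → Fin N → ℂ} (hM : evalMat M v ≠ 0)
    (hdiag : ∀ l, M (Fin.natAdd n l) l ≠ 0)
    (hoff : ∀ l j, j ≠ l → M (Fin.natAdd n l) j = 0) {p q : Fin N} (hpq : p < q)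
    {c : Fin N → ℂ} (hcp : c p ≠ 0) (hc : ∀ l, c l ≠ 0 → p ≤ l ∧ l < q)
    (hA : ∀ a : Fin n, M (Fin.castAdd N a) q = ∑ l, c l * M (Fin.castAdd N a) l) :
    lam q ≤ μ p := by
  have hcq : c q = 0 := by
    by_contra h
    exact lt_irrefl _ (hc q h).2
  obtain ⟨a, ha, ha'⟩ := exists_degree_of_colPol hv0 (hcol.weight q)
  obtain ⟨b, hb, hb'⟩ := exists_degree_of_rowGen hv0 (hrow.weight p)
  have ha2 : lam q = a := by exact_mod_cast ha
  have hb2 : μ p = b := by exact_mod_cast hb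
  rw [ha2, hb2]
  let x : Fin N → ℂ := fun l => M (Fin.natAdd n l) l
  have hx : ∀ l, x l ≠ 0 := hdiag
  -- Scale row `p` of X by `s` and column `q` by 1/s, which multiplies the value by s^(μ_p - λ_q).
  -- Subtracting c_l/s times column `l` from column `q` kills column `q` of A; row operations with
  -- row `p` of X then remove the remaining poles in `s`. The result is `P s`, regular at `s = 0`.
  let P : ℂ → Fin (n + N) → Fin N → ℂ := fun s r j => Fin.addCases
    (fun a => if j = q then 0 else M (Fin.castAdd N a) j)
    (fun l => if l = p then (if j = p then s * x p else if j = q then -(c p * x p) else 0)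
      else if l = q then (if j = p then x q / c p else 0)
      else if j = l then x l else if j = p then -(c l / c p * x l) else 0) r
  have hP : ∀ s : ℂ, s ≠ 0 → evalMat (P s) v = s ^ b * ((s⁻¹) ^ a * evalMat M v) := by
    intro s hs
    let d : Fin (n + N) → ℂ := fun r => Fin.addCases (fun _ => 0)
      (fun l => if l = p then 0 else if l = q then -(x q / (x p * c p * s))
        else x l * c l / (x p * c p * s)) r
    have hd : ∀ r, d r ≠ 0 → rowGen N n (Fin.natAdd n p) r v = 0 := by
      intro r
      refine Fin.addCases (fun a => ?_) (fun l => ?_) r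
      · simp [d]
      · simp only [d, Fin.addCases_right]
        intro hl
        refine hrow.raising p l ?_
        by_cases h1 : l = p
        · simp [h1] at hl
        · by_cases h2 : l = q
          · rw [h2]; exact hpq
          · rw [if_neg h1, if_neg h2] at hl
            have : c l ≠ 0 := fun h => hl (by simp [h])
            exact lt_of_le_of_ne (hc l this).1 (Ne.symm h1)
    have e1 := evalMat_add_row (Fin.natAdd n p) d (by simp [d]) hd (P s)
    have e2 := evalMat_add_to_column (f := v) q (fun l => c l / s) (by simp [hcq])
      (fun l hl => hcol.raising l q (hc l (fun h => hl (by simp [h]))).2)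
      (fun r j => P s r j + d r * P s (Fin.natAdd n p) j)
    rw [← e1, ← e2, ← ha', ← hb']
    congr 2
    have hQl : ∀ a j, P s (Fin.castAdd N a) j + d (Fin.castAdd N a) * P s (Fin.natAdd n p) j =
        if j = q then 0 else M (Fin.castAdd N a) j := by
      intro a j
      simp only [P, d, Fin.addCases_left, zero_mul, add_zero]
    have hQr : ∀ l j, P s (Fin.natAdd n l) j + d (Fin.natAdd n l) * P s (Fin.natAdd n p) j =
        if l = p then (if j = p then s * x p else if j = q then -(c p * x p) else 0)
        else if l = q then (if j = q then x q / s else 0)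
        else if j = l then x l else if j = q then -(x l * c l / s) else 0 := by
      intro l j
      have hxp := hx p
      have hqp := hpq.ne'
      simp only [P, d, Fin.addCases_right, if_true]
      by_cases h1 : l = p
      · simp [h1]
      by_cases h2 : l = q
      · simp only [h2, if_neg hqp, if_true]
        by_cases h3 : j = p
        · simp only [h3, if_true, if_neg hpq.ne]; field_simp; ring
        · by_cases h4 : j = q
          · simp only [h4, if_neg hqp, if_true]; field_simp; ring
          · simp [h3, h4]
      · simp only [if_neg h1, if_neg h2]
        by_cases h3 : j = p
        · simp only [h3, if_true, if_neg hpq.ne, if_neg (Ne.symm h1)]; field_simp; ring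
        · by_cases h4 : j = q
          · simp only [h4, if_neg hqp, if_true, if_neg (Ne.symm h2)]; field_simp; ring
          · simp [h3, h4]
    funext r j
    refine Fin.addCases (fun a => ?_) (fun l => ?_) r
    · have hne : Fin.castAdd N a ≠ Fin.natAdd n p := fun h => by
        have := congrArg Fin.val h
        simp at this
        omega
      simp only [hQl, if_neg hne]
      by_cases h : j = q
      · simp only [h, if_true, zero_add, hA a, Finset.mul_sum]
        refine Finset.sum_congr rfl fun l _ => ?_
        by_cases hl : l = q
        · simp [hl, hcq]
        · simp only [if_neg hl]; ring
      · simp [h]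
    · simp only [hQr, (Fin.natAdd_injective N n).eq_iff]
      by_cases h1 : l = p
      · subst h1
        by_cases h : j = q
        · simp only [h, if_true, if_neg hpq.ne', hoff l q hpq.ne', mul_zero]
          rw [Finset.sum_eq_single l]
          · simp only [if_true]; field_simp; ring
          · intro b _ hb
            by_cases hbq : b = q
            · simp [hbq, hcq]
            · simp [hb, hbq]
          · simp
        · by_cases hj : j = l
          · simp [hj, hpq.ne, x]
          · simp [h, hj, hoff l j hj]
      · simp only [if_neg h1]
        by_cases h2 : l = q
        · subst h2
          by_cases h : j = l
          · simp only [h, if_true]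
            rw [Finset.sum_eq_zero fun b _ => ?_]
            · simp only [x]; field_simp; ring
            · by_cases hbq : b = l
              · simp [hbq, hcq]
              · simp [hbq]
          · simp [h, hoff l j h]
        · simp only [if_neg h2]
          by_cases h : j = q
          · simp only [h, if_true, if_neg (Ne.symm h2), hoff l q (Ne.symm h2), mul_zero]
            rw [Finset.sum_eq_single l]
            · simp only [if_true]; field_simp; ring
            · intro b _ hb
              by_cases hbq : b = q
              · simp [hbq, hcq]
              · simp [hb, hbq]
            · simp
          · by_cases hj : j = l
            · simp [hj, h2, x]
            · simp [h, hj, hoff l j hj]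
  by_contra hlt
  push Not at hlt
  -- If λ_q > μ_p, this function is constant with value `evalMat M v` off 0 and vanishes at 0,
  -- contradicting continuity.
  have hcont : Continuous fun s => s ^ (a - b) * evalMat (P s) v := by
    refine (continuous_pow _).mul ((continuous_evalMat v).comp ?_)
    refine continuous_pi fun r => continuous_pi fun j => ?_
    refine Fin.addCases (fun a => ?_) (fun l => ?_) r
    · simp only [P, Fin.addCases_left]; exact continuous_const
    · simp only [P, Fin.addCases_right]
      split_ifs <;> fun_prop
  have hconst : ∀ s : ℂ, s ≠ 0 → s ^ (a - b) * evalMat (P s) v = evalMat M v := by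
    intro s hs
    rw [hP s hs, ← mul_assoc, ← mul_assoc, ← pow_add, Nat.sub_add_cancel hlt.le, ← mul_pow,
      mul_inv_cancel₀ hs, one_pow, one_mul]
  have h0 : (fun s => s ^ (a - b) * evalMat (P s) v) = fun _ => evalMat M v := by
    refine Continuous.ext_on (s := {(0 : ℂ)}ᶜ) (dense_compl_singleton 0) hcont continuous_const
      fun s hs => hconst s hs
  have h1 := congrFun h0 0
  simp only [zero_pow (Nat.sub_ne_zero_of_lt hlt), zero_mul] at h1
  exact hM h1.symm

theorem isAdmissible_of_hilbertPart_ne_bot (hk : 0 < k) {lam : Fin N → ℕ}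
    (h : hilbertPart N n k lam ≠ ⊥) : IsAdmissible N n k lam := by
  classical
  obtain ⟨h, hh, h0⟩ := (Submodule.ne_bot_iff _).1 h
  obtain ⟨v, hv0, μ, hcol, hrow, hlam⟩ := exists_isHighest_of_mem_hilbertPart hh h0
  have hanti : Antitone lam :=
    hcol.weight_le colPol_commutator (colPol_isUnitaryFamily (Equiv.refl _)) hv0
  refine ⟨hanti, fun i => by rw [hlam]; exact Nat.le_add_left _ _, fun i j hij => ?_⟩
  obtain ⟨M, hM, hdiag⟩ := exists_evalMat_ne_zero_of_diagonal hv0 (Fin.natAdd n)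
    (Fin.natAdd_injective _ _) (Equiv.refl _) (Set.range (Fin.natAdd n)) (fun p => ⟨p, rfl⟩)
    (fun p q hpq => hcol.raising p q hpq) (by
      rintro p _ ⟨l, rfl⟩ hl
      refine hrow.raising p l ?_
      by_contra hpl
      exact hl l (not_lt.1 hpl) rfl)
  have hd : ∀ l, M (Fin.natAdd n l) l ≠ 0 := fun l => (hdiag l).1
  have hoff : ∀ l j, j ≠ l → M (Fin.natAdd n l) j = 0 := fun l j hj => (hdiag l).2.1 j hj
  obtain ⟨c, ⟨l₀, hl₀⟩, hc, hA⟩ := exists_column_relation M i j hij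
  let s : Finset (Fin N) := Finset.univ.filter fun l => c l ≠ 0
  have hs : s.Nonempty := ⟨l₀, by simp [s, hl₀]⟩
  have hmem : ∀ l, l ∈ s ↔ c l ≠ 0 := fun l => by simp [s]
  set p := s.min' hs with hp
  set q := s.max' hs with hq
  have hcp : c p ≠ 0 := (hmem p).1 (s.min'_mem hs)
  have hcq : c q ≠ 0 := (hmem q).1 (s.max'_mem hs)
  -- If the relation involved one column only, that column of A would vanish. Scaling row `p` of X
  -- would then equal scaling column `p`, giving μ_p = λ_p against λ = μ + k with `k` positive.
  have hpq : p < q := by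
    refine lt_of_le_of_ne (s.min'_le _ (s.max'_mem hs)) fun heq => ?_
    -- a single column would vanish
    have hz : ∀ l, l ≠ p → c l = 0 := by
      intro l hl
      by_contra hcl
      have h1 := s.min'_le l ((hmem l).2 hcl)
      have h2 := s.le_max' l ((hmem l).2 hcl)
      exact hl (le_antisymm (h2.trans heq.ge) h1)
    have hAp : ∀ a : Fin n, M (Fin.castAdd N a) p = 0 := by
      intro a
      have := hA a
      rw [Finset.sum_eq_single p (fun l _ hl => by rw [hz l hl, zero_mul]) (by simp)] at this
      exact (mul_eq_zero.1 this).resolve_left hcp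
    obtain ⟨a, ha, ha'⟩ := exists_degree_of_colPol hv0 (hcol.weight p)
    obtain ⟨b, hb, hb'⟩ := exists_degree_of_rowGen hv0 (hrow.weight p)
    have ha2 : lam p = a := by exact_mod_cast ha
    have hb2 : μ p = b := by exact_mod_cast hb
    have h1 : (fun r j => if r = Fin.natAdd n p then 2 * M r j else M r j) =
        fun r j => if j = p then 2 * M r j else M r j := by
      funext r j
      refine Fin.addCases (fun a => ?_) (fun l => ?_) r
      · have hne : Fin.castAdd N a ≠ Fin.natAdd n p := fun h => by
          have := congrArg Fin.val h
          simp at this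
          omega
        rw [if_neg hne]
        split_ifs with h
        · rw [h, hAp, mul_zero]
        · rfl
      · simp only [(Fin.natAdd_injective N n).eq_iff]
        by_cases h1 : l = p <;> by_cases h2 : j = p
        · simp [h1, h2]
        · rw [hoff l j (by rw [h1]; exact h2)]; simp
        · rw [hoff l j (by rw [h2]; exact Ne.symm h1)]; simp
        · simp [h1, h2]
    have h2 := (hb' M 2).symm.trans ((congrArg (fun M => evalMat M v) h1).trans (ha' M 2))
    have h3 : (2 : ℂ) ^ b = 2 ^ a := mul_right_cancel₀ hM h2
    have h4 : (2 : ℕ) ^ b = 2 ^ a := by exact_mod_cast h3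
    have h5 := Nat.pow_right_injective le_rfl h4
    have h6 := hlam p
    omega
  have key : lam q ≤ μ p := by
    refine weight_le_of_column_relation hv0 hcol hrow hM hd hoff hpq
      (c := fun l => if l = q then 0 else -(c l / c q)) ?_ ?_ ?_
    · simp only [if_neg hpq.ne]
      exact neg_ne_zero.2 (div_ne_zero hcp hcq)
    · intro l hl
      by_cases hlq : l = q
      · simp [hlq] at hl
      · have hcl : c l ≠ 0 := fun h => hl (by simp [h])
        exact ⟨s.min'_le l ((hmem l).2 hcl), lt_of_le_of_ne (s.le_max' l ((hmem l).2 hcl)) hlq⟩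
    · intro a
      have h1 := hA a
      rw [← Finset.add_sum_erase _ _ (Finset.mem_univ q)] at h1
      rw [← Finset.add_sum_erase _ _ (Finset.mem_univ q), if_pos rfl, zero_mul, zero_add]
      have h2 : ∑ l ∈ Finset.univ.erase q, (if l = q then 0 else -(c l / c q)) *
          M (Fin.castAdd N a) l =
          -(∑ l ∈ Finset.univ.erase q, c l * M (Fin.castAdd N a) l) / c q := by
        rw [← Finset.sum_neg_distrib, Finset.sum_div]
        refine Finset.sum_congr rfl fun l hl => ?_
        rw [if_neg (Finset.ne_of_mem_erase hl)]
        ring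
      rw [h2, eq_div_iff hcq, ← add_eq_zero_iff_eq_neg, mul_comm]
      exact h1
  -- Together: λ_j ≤ λ_q ≤ μ_p = λ_p - k ≤ λ_i - k.
  have h1 := hanti (hc q hcq).2
  have h2 := hanti (hc p hcp).1
  have h3 := hlam p
  omega

end Admissible

/-! ### Explicit highest weight vectors as products of minors. -/

section Minors

variable {N n : ℕ}

theorem evalMat_smul (M : Fin (n + N) → Fin N → ℂ) (c : ℂ) (f : Poly N n) :
    evalMat M (c • f) = c * evalMat M f := by
  rw [evalMat, smul_eq_C_mul, map_mul, eval_C]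

theorem hasDerivAt_one_add_mul (d a : ℂ) : HasDerivAt (fun t : ℂ => (1 + t * d) * a) (d * a) 0 := by
  simpa using (((hasDerivAt_id (0 : ℂ)).mul_const d).const_add 1).mul_const a

/-- Differentiating the group action at `t = 0`; the factor `1 + t * d` covers scaling (`d = 1`) and
invariance (`d = 0`) together. -/
theorem colPol_eq_smul_of_evalMat {f : Poly N n} {p q : Fin N} {d : ℂ}
    (h : ∀ (M : Fin (n + N) → Fin N → ℂ) (t : ℂ),
      evalMat (fun r j => M r j + t * (if j = q then M r p else 0)) f =
        (1 + t * d) * evalMat M f) : colPol N n p q f = d • f := by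
  refine evalMat_ext fun M => ?_
  have h1 := hasDerivAt_eval f (fun x => M x.1 x.2) (fun x => if x.2 = q then M x.1 p else 0) 0
  have h2 := (h1.congr_of_eventuallyEq (Filter.Eventually.of_forall fun t => (h M t).symm)).unique
    (hasDerivAt_one_add_mul d (evalMat M f))
  rw [evalMat_colPol, evalMat_smul, ← h2, Fintype.sum_prod_type]
  refine Finset.sum_congr rfl fun r _ => ?_
  simp only [zero_mul, add_zero, ite_mul]
  rw [Finset.sum_ite_eq' Finset.univ q, if_pos (Finset.mem_univ q)]
  rfl

theorem rowGen_eq_smul_of_evalMat {f : Poly N n} {p q : Fin (n + N)} {d : ℂ}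
    (h : ∀ (M : Fin (n + N) → Fin N → ℂ) (t : ℂ),
      evalMat (fun r j => M r j + t * (if r = q then M p j else 0)) f =
        (1 + t * d) * evalMat M f) : rowGen N n p q f = d • f := by
  refine evalMat_ext fun M => ?_
  have h1 := hasDerivAt_eval f (fun x => M x.1 x.2) (fun x => if x.1 = q then M p x.2 else 0) 0
  have h2 := (h1.congr_of_eventuallyEq (Filter.Eventually.of_forall fun t => (h M t).symm)).unique
    (hasDerivAt_one_add_mul d (evalMat M f))
  rw [evalMat_rowGen, evalMat_smul, ← h2, Fintype.sum_prod_type_right]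
  refine Finset.sum_congr rfl fun r _ => ?_
  simp only [zero_mul, add_zero, ite_mul]
  rw [Finset.sum_ite_eq' Finset.univ q, if_pos (Finset.mem_univ q)]
  rfl

theorem derivation_prod_eq_smul {ι : Type*} (D : Derivation ℂ (Poly N n) (Poly N n))
    (s : Finset ι) (f : ι → Poly N n) (d : ι → ℂ) (h : ∀ i ∈ s, D (f i) = d i • f i) :
    D (∏ i ∈ s, f i) = (∑ i ∈ s, d i) • ∏ i ∈ s, f i := by
  classical
  induction s using Finset.induction_on with
  | empty => simp
  | insert i s hi ih =>
    rw [Finset.prod_insert hi, Finset.sum_insert hi, Derivation.leibniz,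
      ih fun j hj => h j (Finset.mem_insert_of_mem hj), h i (Finset.mem_insert_self i s), add_smul]
    simp only [smul_eq_mul, mul_smul_comm]
    rw [mul_comm (∏ x ∈ s, f x) (f i), add_comm]

/-- The row of the stacked matrix that goes with the box in column `c` and row `a` of a diagram:
a row of `X` for a box of `μ`, otherwise a row of `A`. -/
def boxRow (hn : 0 < n) (μ : Fin N → ℕ) (c : ℕ) (a : Fin N) : Fin (n + N) :=
  if c < μ a then Fin.natAdd n a else Fin.castAdd N ⟨a % n, Nat.mod_lt _ hn⟩

/-- The minor attached to column `c` of the diagram `lam`. -/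
def columnMinor (hn : 0 < n) (lam μ : Fin N → ℕ) (c : ℕ) : Poly N n :=
  Matrix.det (Matrix.of fun a b : {a : Fin N // c < lam a} =>
    (X (boxRow hn μ c a, (b : Fin N)) : Poly N n))

theorem evalMat_columnMinor (hn : 0 < n) (lam μ : Fin N → ℕ) (c : ℕ)
    (M : Fin (n + N) → Fin N → ℂ) : evalMat M (columnMinor hn lam μ c) =
      Matrix.det (Matrix.of fun a b : {a : Fin N // c < lam a} => M (boxRow hn μ c a) b) := by
  rw [columnMinor, RingHom.map_det]
  congr 1
  ext a b
  simp [evalMat]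

theorem natAdd_ne_castAdd (a : Fin n) (b : Fin N) : Fin.natAdd n b ≠ Fin.castAdd N a := fun h => by
  have := congrArg Fin.val h
  simp at this
  omega

/-- Since `lam` is antitone, the minor uses an initial segment of columns, so with column `q` it
contains column `p ≤ q`, and adding the latter to the former leaves the determinant alone. -/
theorem colPol_columnMinor (hn : 0 < n) {lam : Fin N → ℕ} (hlam : Antitone lam) (μ : Fin N → ℕ)
    (c : ℕ) {p q : Fin N} (hpq : p ≤ q) : colPol N n p q (columnMinor hn lam μ c) =
      (if p = q ∧ c < lam p then (1 : ℂ) else 0) • columnMinor hn lam μ c := by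
  refine colPol_eq_smul_of_evalMat fun M t => ?_
  rw [evalMat_columnMinor, evalMat_columnMinor]
  by_cases hq : c < lam q
  · have hp : c < lam p := hq.trans_le (hlam hpq)
    set B : Matrix {a : Fin N // c < lam a} {a : Fin N // c < lam a} ℂ :=
      Matrix.of fun a b => M (boxRow hn μ c a) b with hB
    have h1 : (Matrix.of fun a b : {a : Fin N // c < lam a} => M (boxRow hn μ c a) b +
        t * (if (b : Fin N) = q then M (boxRow hn μ c a) p else 0)) =
        B.updateCol ⟨q, hq⟩ fun a => B a ⟨q, hq⟩ + t • B a ⟨p, hp⟩ := by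
      ext a b
      rw [Matrix.updateCol_apply]
      by_cases hb : b = ⟨q, hq⟩
      · rw [if_pos hb]; simp [hB, hb]
      · have : (b : Fin N) ≠ q := fun h => hb (Subtype.ext h)
        rw [if_neg hb]; simp [hB, this]
    rw [h1]
    by_cases hne : p = q
    · subst hne
      have h2 : (fun a => B a ⟨p, hq⟩ + t • B a ⟨p, hp⟩) = (1 + t) • fun a => B a ⟨p, hq⟩ := by
        funext a; simp [add_mul]
      rw [h2, Matrix.det_updateCol_smul, if_pos ⟨rfl, hp⟩, mul_one]
      congr 2
      exact Matrix.updateCol_eq_self B ⟨p, hq⟩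
    · rw [Matrix.det_updateCol_add_smul_self _ (fun h => hne (congrArg Subtype.val h).symm),
        if_neg fun h => hne h.1, mul_zero, add_zero, one_mul]
  · have h1 : ¬ (p = q ∧ c < lam p) := fun h => hq (h.1 ▸ h.2)
    rw [if_neg h1, mul_zero, add_zero, one_mul]
    congr 2
    funext a b
    have : (b : Fin N) ≠ q := fun h => hq (h ▸ b.2)
    simp [this]

/-- The rows of X that occur form an initial segment because `μ` is antitone, so the same argument
works on rows. -/
theorem lowerRowGen_columnMinor (hn : 0 < n) {lam μ : Fin N → ℕ} (hμ : Antitone μ)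
    (hle : μ ≤ lam) (c : ℕ) {p q : Fin N} (hpq : p ≤ q) :
    lowerRowGen N n p q (columnMinor hn lam μ c) =
      (if p = q ∧ c < μ p then (1 : ℂ) else 0) • columnMinor hn lam μ c := by
  refine rowGen_eq_smul_of_evalMat fun M t => ?_
  rw [evalMat_columnMinor, evalMat_columnMinor]
  by_cases hq : c < μ q
  · have hp : c < μ p := hq.trans_le (hμ hpq)
    set B : Matrix {a : Fin N // c < lam a} {a : Fin N // c < lam a} ℂ :=
      Matrix.of fun a b => M (boxRow hn μ c a) b with hB
    let q' : {a : Fin N // c < lam a} := ⟨q, hq.trans_le (hle q)⟩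
    let p' : {a : Fin N // c < lam a} := ⟨p, hp.trans_le (hle p)⟩
    have hbq : boxRow hn μ c q = Fin.natAdd n q := if_pos hq
    have hbp : boxRow hn μ c p = Fin.natAdd n p := if_pos hp
    have h1 : (Matrix.of fun a b : {a : Fin N // c < lam a} => M (boxRow hn μ c a) b +
        t * (if boxRow hn μ c a = Fin.natAdd n q then M (Fin.natAdd n p) b else 0)) =
        B.updateRow q' (B q' + t • B p') := by
      ext a b
      rw [Matrix.updateRow_apply]
      by_cases ha : a = q'
      · rw [if_pos ha]; simp [hB, ha, q', p', hbq, hbp]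
      · have : boxRow hn μ c a ≠ Fin.natAdd n q := by
          unfold boxRow
          split_ifs with h
          · exact fun h => ha (Subtype.ext (Fin.natAdd_injective _ _ h))
          · exact (natAdd_ne_castAdd _ _).symm
        rw [if_neg ha]; simp [hB, this]
    rw [h1]
    by_cases hne : p = q
    · subst hne
      have h2 : B q' + t • B p' = (1 + t) • B q' := by
        rw [add_smul, one_smul]
      rw [h2, Matrix.det_updateRow_smul, if_pos ⟨rfl, hp⟩, mul_one]
      congr 2
      exact Matrix.updateRow_eq_self B q'
    · rw [Matrix.det_updateRow_add_smul_self _ (fun h => hne (congrArg Subtype.val h).symm),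
        if_neg fun h => hne h.1, mul_zero, add_zero, one_mul]
  · have h1 : ¬ (p = q ∧ c < μ p) := fun h => hq (h.1 ▸ h.2)
    rw [if_neg h1, mul_zero, add_zero, one_mul]
    congr 2
    funext a b
    have : boxRow hn μ c a ≠ Fin.natAdd n q := by
      unfold boxRow
      split_ifs with h
      · exact fun h2 => hq (Fin.natAdd_injective _ _ h2 ▸ h)
      · exact (natAdd_ne_castAdd _ _).symm
    simp [this]

/-- The chosen rows are distinct: two A-rows can agree only for boxes at distance at least `n`, and
then λ_b ≤ μ_a ≤ c excludes the lower box. A suitable 0/1 matrix turns the minor into det 1. -/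
theorem columnMinor_ne_zero (hn : 0 < n) {lam μ : Fin N → ℕ}
    (hgap : ∀ i j : Fin N, (i : ℕ) + n ≤ j → lam j ≤ μ i) (c : ℕ) :
    columnMinor hn lam μ c ≠ 0 := by
  have hinj : ∀ a b : {a : Fin N // c < lam a}, boxRow hn μ c a = boxRow hn μ c b → a = b := by
    have key : ∀ a b : {a : Fin N // c < lam a}, ¬ c < μ a →
        ((a : Fin N) : ℕ) % n = ((b : Fin N) : ℕ) % n → b.1 ≤ a.1 := by
      intro a b ha h
      by_contra hlt
      have hlt' : ((a : Fin N) : ℕ) < (b : Fin N) := not_le.1 hlt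
      have h1 := (Nat.modEq_iff_dvd' hlt'.le).1 h
      have h2 := Nat.le_of_dvd (by omega) h1
      have h3 := hgap a b (by omega)
      have := b.2
      omega
    intro a b h
    unfold boxRow at h
    split_ifs at h with h1 h2 h2
    · exact Subtype.ext (Fin.natAdd_injective _ _ h)
    · exact absurd h (natAdd_ne_castAdd _ _)
    · exact absurd h.symm (natAdd_ne_castAdd _ _)
    · have h3 : ((a : Fin N) : ℕ) % n = ((b : Fin N) : ℕ) % n := by
        simpa using congrArg Fin.val h
      exact Subtype.ext (le_antisymm (key b a h2 h3.symm) (key a b h1 h3))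
  intro h0
  have h1 := evalMat_columnMinor hn lam μ c
    (fun r j => if c < lam j ∧ boxRow hn μ c j = r then 1 else 0)
  rw [h0, map_zero] at h1
  have h2 : (Matrix.of fun a b : {a : Fin N // c < lam a} =>
      if c < lam b ∧ boxRow hn μ c b = boxRow hn μ c a then (1 : ℂ) else 0) = 1 := by
    ext a b
    rw [Matrix.one_apply]
    by_cases h : a = b
    · simp [h, b.2]
    · have : boxRow hn μ c b ≠ boxRow hn μ c a := fun h' => h (hinj _ _ h'.symm)
      simp [h, this]
  rw [h2, Matrix.det_one] at h1
  exact zero_ne_one h1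

/-- The product of the minors of all columns of the diagram `lam`. -/
def minorProduct (hn : 0 < n) (lam μ : Fin N → ℕ) : Poly N n :=
  -- The range need only bound every λ_i: beyond the last column of the diagram the minor is an
  -- empty determinant, equal to 1.
  ∏ c ∈ Finset.range (∑ i, lam i), columnMinor hn lam μ c

theorem sum_range_ite_lt {L m : ℕ} (h : m ≤ L) :
    ∑ c ∈ Finset.range L, (if c < m then (1 : ℂ) else 0) = m := by
  rw [Finset.sum_ite, Finset.sum_const_zero, add_zero, Finset.sum_const, nsmul_one]
  congr 1
  have : Finset.filter (fun c => c < m) (Finset.range L) = Finset.range m := by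
    ext c; simp; omega
  rw [this, Finset.card_range]

theorem minorProduct_isHighest_colPol (hn : 0 < n) {lam : Fin N → ℕ} (hlam : Antitone lam)
    (μ : Fin N → ℕ) :
    IsHighest (colPol N n) (fun i => (lam i : ℂ)) (minorProduct hn lam μ) := by
  have key : ∀ p q : Fin N, p ≤ q → colPol N n p q (minorProduct hn lam μ) = (∑ c ∈ Finset.range
      (∑ i, lam i), if p = q ∧ c < lam p then (1 : ℂ) else 0) • minorProduct hn lam μ := by
    intro p q hpq
    rw [← colDer_apply]
    refine derivation_prod_eq_smul _ _ _ _ fun c _ => ?_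
    rw [colDer_apply, colPol_columnMinor hn hlam μ c hpq]
  refine ⟨fun p q hpq => ?_, fun p => ?_⟩
  · rw [key p q hpq.le]
    simp [hpq.ne]
  · rw [key p p le_rfl]
    simp only [true_and]
    rw [sum_range_ite_lt (Finset.single_le_sum (fun _ _ => Nat.zero_le _) (Finset.mem_univ p))]

theorem minorProduct_isHighest_lowerRowGen (hn : 0 < n) {lam μ : Fin N → ℕ} (hμ : Antitone μ)
    (hle : μ ≤ lam) :
    IsHighest (lowerRowGen N n) (fun i => (μ i : ℂ)) (minorProduct hn lam μ) := by
  have key : ∀ p q : Fin N, p ≤ q → lowerRowGen N n p q (minorProduct hn lam μ) =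
      (∑ c ∈ Finset.range (∑ i, lam i), if p = q ∧ c < μ p then (1 : ℂ) else 0) •
        minorProduct hn lam μ := by
    intro p q hpq
    unfold lowerRowGen
    rw [← rowDer_apply]
    refine derivation_prod_eq_smul _ _ _ _ fun c _ => ?_
    rw [rowDer_apply]
    exact lowerRowGen_columnMinor hn hμ hle c hpq
  refine ⟨fun p q hpq => ?_, fun p => ?_⟩
  · rw [key p q hpq.le]
    simp [hpq.ne]
  · rw [key p p le_rfl]
    simp only [true_and]
    rw [sum_range_ite_lt ((hle p).trans
      (Finset.single_le_sum (fun _ _ => Nat.zero_le _) (Finset.mem_univ p)))]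

theorem minorProduct_ne_zero (hn : 0 < n) {lam μ : Fin N → ℕ}
    (hgap : ∀ i j : Fin N, (i : ℕ) + n ≤ j → lam j ≤ μ i) : minorProduct hn lam μ ≠ 0 :=
  Finset.prod_ne_zero_iff.2 fun c _ => columnMinor_ne_zero hn hgap c

/-- The point `A = 0`, `X = 1`. -/
def basePoint (N n : ℕ) (r : Fin (n + N)) (j : Fin N) : ℂ :=
  Fin.addCases (fun _ => 0) (fun l => if l = j then 1 else 0) r

theorem evalMat_basePoint_minorProduct (hn : 0 < n) (μ : Fin N → ℕ) :
    evalMat (basePoint N n) (minorProduct hn μ μ) = 1 := by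
  rw [minorProduct, map_prod]
  refine Finset.prod_eq_one fun c _ => ?_
  rw [evalMat_columnMinor]
  have : (Matrix.of fun a b : {a : Fin N // c < μ a} => basePoint N n (boxRow hn μ c a) b) = 1 := by
    ext a b
    rw [Matrix.one_apply]
    simp [boxRow, a.2, basePoint, Subtype.ext_iff]
  rw [this, Matrix.det_one]

/-- At X = 1, A = 0 an infinitesimal row operation on X and the transposed column operation move the
point in the same direction. Hence evaluation there is invariant under the untwisted diagonal
action. -/
theorem evalMat_basePoint_lowerRowGen (i j : Fin N) (f : Poly N n) :
    evalMat (basePoint N n) (lowerRowGen N n i j f) =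
      evalMat (basePoint N n) (colPol N n j i f) := by
  unfold lowerRowGen
  rw [evalMat_rowGen, evalMat_colPol, Fin.sum_univ_add]
  simp [basePoint]

end Minors

/-! ### Sufficiency of admissibility: constructing invariants. -/

section Existence

variable {N n : ℕ}

/-- `colPol` twisted by `k` times the trace character. -/
def twistedColPol (N n k : ℕ) (i j : Fin N) : Op N n :=
  colPol N n i j + (if i = j then (k : ℂ) else 0) • 1

/-- The action on pairs of polynomials whose second factor is twisted. -/
def pairOp (N n k : ℕ) : (Fin N × Fin N) ⊕ (Fin N × Fin N) → Module.End ℂ (Poly N n × Poly N n)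
  | .inl p => (lowerRowGen N n p.1 p.2).prodMap (lowerRowGen N n p.1 p.2)
  | .inr p => (colPol N n p.1 p.2).prodMap (twistedColPol N n k p.1 p.2)

/-- The lowering and diagonal members of `pairOp`. -/
def IsNonraising : (Fin N × Fin N) ⊕ (Fin N × Fin N) → Prop
  | .inl p => ¬ p.1 < p.2
  | .inr p => ¬ p.1 < p.2

theorem twistedColPol_apply (k : ℕ) (i j : Fin N) (f : Poly N n) :
    twistedColPol N n k i j f = colPol N n i j f + (if i = j then (k : ℂ) else 0) • f := by
  rw [twistedColPol, LinearMap.add_apply, LinearMap.smul_apply, Module.End.one_apply]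

theorem twistedColPol_commutator (k : ℕ) (r s t u : Fin N) :
    twistedColPol N n k r s * twistedColPol N n k t u -
        twistedColPol N n k t u * twistedColPol N n k r s =
      (if s = t then twistedColPol N n k r u else 0) -
        (if u = r then twistedColPol N n k t s else 0) := by
  have h1 : twistedColPol N n k r s * twistedColPol N n k t u -
      twistedColPol N n k t u * twistedColPol N n k r s =
      colPol N n r s * colPol N n t u - colPol N n t u * colPol N n r s := by
    simp only [twistedColPol, add_mul, mul_add, smul_mul_assoc, mul_smul_comm, mul_one, one_mul,
      smul_add]
    rw [smul_comm (if r = s then (k : ℂ) else 0) (if t = u then (k : ℂ) else 0)]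
    abel
  rw [h1, colPol_commutator]
  unfold twistedColPol
  by_cases hst : s = t <;> by_cases hur : u = r
  · subst hst hur; simp
  · subst hst; simp [hur, Ne.symm hur]
  · subst hur; simp [hst, Ne.symm hst]
  · simp [hst, hur]

theorem twistedColPol_mul_lowerRowGen (k : ℕ) (i j a b : Fin N) :
    lowerRowGen N n i j * twistedColPol N n k a b =
      twistedColPol N n k a b * lowerRowGen N n i j := by
  rw [twistedColPol, mul_add, add_mul, lowerRowGen_mul_colPol]
  simp

theorem lowerRowGen_commutator (r s t u : Fin N) :
    lowerRowGen N n r s * lowerRowGen N n t u - lowerRowGen N n t u * lowerRowGen N n r s =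
      (if s = t then lowerRowGen N n r u else 0) - (if u = r then lowerRowGen N n t s else 0) := by
  unfold lowerRowGen
  rw [rowGen_commutator]
  simp only [(Fin.natAdd_injective N n).eq_iff]

theorem prodMap_commutator {V : Type*} [AddCommGroup V] [Module ℂ V] (a b c d : Module.End ℂ V) :
    (LinearMap.prodMap a b * LinearMap.prodMap c d -
      LinearMap.prodMap c d * LinearMap.prodMap a b : Module.End ℂ (V × V)) =
      LinearMap.prodMap (a * c - c * a) (b * d - d * b) := by
  refine LinearMap.ext fun x => ?_
  simp

theorem prodMap_ite_sub_ite {V : Type*} [AddCommGroup V] [Module ℂ V] (P Q : Prop) [Decidable P]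
    [Decidable Q] (a b c d : Module.End ℂ V) :
    (LinearMap.prodMap ((if P then a else 0) - (if Q then b else 0))
      ((if P then c else 0) - (if Q then d else 0)) : Module.End ℂ (V × V)) =
    (if P then LinearMap.prodMap a c else 0) - (if Q then LinearMap.prodMap b d else 0) := by
  refine LinearMap.ext fun x => ?_
  split_ifs <;> simp

theorem pairOp_bracket (k : ℕ) (a b : (Fin N × Fin N) ⊕ (Fin N × Fin N)) :
    pairOp N n k a * pairOp N n k b - pairOp N n k b * pairOp N n k a ∈
      Submodule.span ℂ (Set.range (pairOp N n k)) := by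
  have hmem : ∀ c, pairOp N n k c ∈ Submodule.span ℂ (Set.range (pairOp N n k)) :=
    fun c => Submodule.subset_span ⟨c, rfl⟩
  rcases a with ⟨i, j⟩ | ⟨i, j⟩ <;> rcases b with ⟨l, m⟩ | ⟨l, m⟩ <;>
    simp only [pairOp, prodMap_commutator]
  · rw [lowerRowGen_commutator, prodMap_ite_sub_ite]
    refine Submodule.sub_mem _ ?_ ?_ <;> split_ifs <;>
      first | exact hmem (.inl (_, _)) | exact zero_mem _
  · rw [lowerRowGen_mul_colPol, twistedColPol_mul_lowerRowGen, sub_self, sub_self]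
    convert zero_mem (Submodule.span ℂ (Set.range (pairOp N n k)))
    exact LinearMap.prodMap_zero
  · rw [← lowerRowGen_mul_colPol, ← twistedColPol_mul_lowerRowGen, sub_self, sub_self]
    convert zero_mem (Submodule.span ℂ (Set.range (pairOp N n k)))
    exact LinearMap.prodMap_zero
  · rw [colPol_commutator, twistedColPol_commutator, prodMap_ite_sub_ite]
    refine Submodule.sub_mem _ ?_ ?_ <;> split_ifs <;>
      first | exact hmem (.inr (_, _)) | exact zero_mem _

theorem inner_twistedColPol_left (k : ℕ) (i j : Fin N) (f g : Poly N n) :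
    ⟪twistedColPol N n k i j f, g⟫_ℂ = ⟪f, twistedColPol N n k j i g⟫_ℂ := by
  rw [twistedColPol_apply, twistedColPol_apply, inner_add_left, inner_add_right,
    inner_colPol_left, inner_smul_left, inner_smul_right]
  by_cases h : i = j
  · simp [h]
  · simp [h, Ne.symm h]

theorem inner_lowerRowGen_left (i j : Fin N) (f g : Poly N n) :
    ⟪lowerRowGen N n i j f, g⟫_ℂ = ⟪f, lowerRowGen N n j i g⟫_ℂ :=
  inner_rowGen_left _ _ f g

/-- Swapping the two indices, which gives the adjoint operator. -/
def swapIndex : (Fin N × Fin N) ⊕ (Fin N × Fin N) → (Fin N × Fin N) ⊕ (Fin N × Fin N) :=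
  Sum.map Prod.swap Prod.swap

theorem inner_pairOp_fst (k : ℕ) (a : (Fin N × Fin N) ⊕ (Fin N × Fin N))
    (x y : Poly N n × Poly N n) :
    ⟪(pairOp N n k a x).1, y.1⟫_ℂ = ⟪x.1, (pairOp N n k (swapIndex a) y).1⟫_ℂ := by
  rcases a with a | a
  · exact inner_lowerRowGen_left _ _ _ _
  · exact inner_colPol_left _ _ _ _

theorem inner_pairOp_snd (k : ℕ) (a : (Fin N × Fin N) ⊕ (Fin N × Fin N))
    (x y : Poly N n × Poly N n) :
    ⟪(pairOp N n k a x).2, y.2⟫_ℂ = ⟪x.2, (pairOp N n k (swapIndex a) y).2⟫_ℂ := by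
  rcases a with a | a
  · exact inner_lowerRowGen_left _ _ _ _
  · exact inner_twistedColPol_left _ _ _ _ _

theorem swapIndex_swapIndex (a : (Fin N × Fin N) ⊕ (Fin N × Fin N)) :
    swapIndex (swapIndex a) = a := by
  rcases a with a | a <;> rfl

/-- The submodule generated by a pair of highest weight vectors is the graph of an injective
map. -/
theorem eq_zero_of_mem_pair_stableSpan {k : ℕ} {lam μ : Fin N → ℕ} (hlam : ∀ i, lam i = μ i + k)
    {g₁ g₂ : Poly N n} (h₁0 : g₁ ≠ 0)
    (h₁c : IsHighest (colPol N n) (fun i => (lam i : ℂ)) g₁)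
    (h₁r : IsHighest (lowerRowGen N n) (fun i => (μ i : ℂ)) g₁)
    (h₂c : IsHighest (colPol N n) (fun i => (μ i : ℂ)) g₂)
    (h₂r : IsHighest (lowerRowGen N n) (fun i => (μ i : ℂ)) g₂) :
    (∀ a, ∀ x ∈ stableSpan (pairOp N n k) IsNonraising {(g₁, g₂)},
      pairOp N n k a x ∈ stableSpan (pairOp N n k) IsNonraising {(g₁, g₂)}) ∧
    ∀ y, ((0, y) : Poly N n × Poly N n) ∈ stableSpan (pairOp N n k) IsNonraising {(g₁, g₂)} →
      y = 0 := by
  set Q := stableSpan (pairOp N n k) IsNonraising {(g₁, g₂)} with hQ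
  -- each nonraising operator has an adjoint acting on `(g₁, g₂)` by a real scalar
  have hg : ∀ a : (Fin N × Fin N) ⊕ (Fin N × Fin N), IsNonraising a →
      ∃ c : ℕ, pairOp N n k (swapIndex a) (g₁, g₂) = (c : ℂ) • (g₁, g₂) := by
    rintro (⟨i, j⟩ | ⟨i, j⟩) ha
    · rcases (not_lt.1 ha).lt_or_eq with h | h
      · refine ⟨0, ?_⟩
        change (lowerRowGen N n j i g₁, lowerRowGen N n j i g₂) = _
        rw [h₁r.raising j i h, h₂r.raising j i h]
        simp
      · obtain rfl : j = i := h
        refine ⟨μ j, ?_⟩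
        change (lowerRowGen N n j j g₁, lowerRowGen N n j j g₂) = _
        rw [h₁r.weight, h₂r.weight]
        rfl
    · rcases (not_lt.1 ha).lt_or_eq with h | h
      · refine ⟨0, ?_⟩
        change (colPol N n j i g₁, twistedColPol N n k j i g₂) = _
        have h : j < i := h
        rw [twistedColPol_apply, h₁c.raising j i h, h₂c.raising j i h, if_neg h.ne]
        simp
      · obtain rfl : j = i := h
        refine ⟨lam j, ?_⟩
        change (colPol N n j j g₁, twistedColPol N n k j j g₂) = _
        rw [twistedColPol_apply, h₁c.weight, h₂c.weight, if_pos rfl, ← add_smul, hlam]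
        push_cast
        rfl
  have hst : ∀ a, ∀ x ∈ Q, pairOp N n k a x ∈ Q := by
    refine fun a x hx => op_mem_stableSpan_of_bracket (pairOp_bracket k) ?_ a hx
    rintro (⟨i, j⟩ | ⟨i, j⟩) ha x hx
    · have hij : i < j := not_not.1 ha
      rw [Set.mem_singleton_iff.1 hx]
      have : pairOp N n k (.inl (i, j)) (g₁, g₂) = 0 := by
        change (lowerRowGen N n i j g₁, lowerRowGen N n i j g₂) = 0
        rw [h₁r.raising i j hij, h₂r.raising i j hij]
        rfl
      rw [this]
      exact zero_mem _
    · have hij : i < j := not_not.1 ha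
      rw [Set.mem_singleton_iff.1 hx]
      have : pairOp N n k (.inr (i, j)) (g₁, g₂) = 0 := by
        change (colPol N n i j g₁, twistedColPol N n k i j g₂) = 0
        rw [twistedColPol_apply, h₁c.raising i j hij, h₂c.raising i j hij, if_neg hij.ne]
        simp
      rw [this]
      exact zero_mem _
  refine ⟨hst, ?_⟩
  set a := ⟪g₁, g₁⟫_ℂ with ha
  set b := ⟪g₂, g₂⟫_ℂ with hb
  -- proportionality of the two inner products, first against the generator
  have hgen : ∀ x ∈ Q, b * ⟪g₁, x.1⟫_ℂ = a * ⟪g₂, x.2⟫_ℂ := by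
    let K : Submodule ℂ (Poly N n × Poly N n) :=
      { carrier := {x | b * ⟪g₁, x.1⟫_ℂ = a * ⟪g₂, x.2⟫_ℂ}
        add_mem' := fun {x y} hx hy => by
          simp only [Set.mem_ofPred_eq, Prod.fst_add, Prod.snd_add, inner_add_right,
            mul_add] at *
          rw [hx, hy]
        zero_mem' := by simp
        smul_mem' := fun c x hx => by
          simp only [Set.mem_ofPred_eq, Prod.smul_fst, Prod.smul_snd, inner_smul_right] at *
          rw [mul_left_comm, hx, mul_left_comm] }
    refine fun x hx => (stableSpan_le (S := K) ?_ ?_ : Q ≤ K) hx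
    · rw [Set.singleton_subset_iff]
      change b * a = a * b
      ring
    · intro c hc x hx
      obtain ⟨d, hd⟩ := hg c hc
      change b * ⟪g₁, (pairOp N n k c x).1⟫_ℂ = a * ⟪g₂, (pairOp N n k c x).2⟫_ℂ
      have e1 := inner_pairOp_fst k (swapIndex c) (g₁, g₂) x
      have e2 := inner_pairOp_snd k (swapIndex c) (g₁, g₂) x
      rw [swapIndex_swapIndex, hd] at e1 e2
      rw [← e1, ← e2]
      simp only [Prod.smul_fst, Prod.smul_snd, inner_smul_left]
      rw [mul_left_comm, show b * ⟪g₁, x.1⟫_ℂ = a * ⟪g₂, x.2⟫_ℂ from hx, mul_left_comm]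
  have hall : ∀ x ∈ Q, ∀ y ∈ Q, b * ⟪y.1, x.1⟫_ℂ = a * ⟪y.2, x.2⟫_ℂ := by
    let K : Submodule ℂ (Poly N n × Poly N n) :=
      { carrier := {x | ∀ y ∈ Q, b * ⟪y.1, x.1⟫_ℂ = a * ⟪y.2, x.2⟫_ℂ}
        add_mem' := fun {x x'} hx hx' y hy => by
          simp only [Prod.fst_add, Prod.snd_add, inner_add_right, mul_add]
          rw [hx y hy, hx' y hy]
        zero_mem' := by simp
        smul_mem' := fun c x hx y hy => by
          simp only [Prod.smul_fst, Prod.smul_snd, inner_smul_right]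
          rw [mul_left_comm, hx y hy, mul_left_comm] }
    refine fun x hx => (stableSpan_le (S := K) ?_ ?_ : Q ≤ K) hx
    · rw [Set.singleton_subset_iff]
      intro y hy
      have h1 := congrArg (starRingEnd ℂ) (hgen y hy)
      simp only [map_mul, ha, hb, inner_conj_symm] at h1
      exact h1
    · intro c _ x hx y hy
      have e1 := inner_pairOp_fst k (swapIndex c) y x
      have e2 := inner_pairOp_snd k (swapIndex c) y x
      rw [swapIndex_swapIndex] at e1 e2
      rw [← e1, ← e2]
      exact hx _ (hst _ y hy)
  intro y hy
  -- The inner products of the two coordinates are proportional on `Q`, so a vanishing first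
  -- coordinate forces the second to have norm 0.
  have h1 := hall _ hy _ hy
  simp only [inner_zero_left, mul_zero] at h1
  have h2 := (mul_eq_zero.1 h1.symm).resolve_left (inner_self_ne_zero.2 h₁0)
  exact inner_self_eq_zero.1 h2

theorem hilbertPart_ne_bot {k : ℕ} (hn : 0 < n) {lam : Fin N → ℕ} (hadm : IsAdmissible N n k lam) :
    hilbertPart N n k lam ≠ ⊥ := by
  intro hbot
  let μ : Fin N → ℕ := fun i => lam i - k
  have hlam : ∀ i, lam i = μ i + k := fun i => (Nat.sub_add_cancel (hadm.le i)).symm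
  have hμ : Antitone μ := fun i j hij => Nat.sub_le_sub_right (hadm.antitone hij) k
  have hle : μ ≤ lam := fun i => Nat.sub_le _ _
  let g₁ : Poly N n := minorProduct hn lam μ
  let g₂ : Poly N n := minorProduct hn μ μ
  have hg₁0 : g₁ ≠ 0 := by
    refine minorProduct_ne_zero hn fun i j hij => ?_
    have h1 := hadm.gap i ⟨i + n, hij.trans_lt j.2⟩ rfl
    have h2 : lam j ≤ lam ⟨i + n, hij.trans_lt j.2⟩ := hadm.antitone (Fin.le_def.2 hij)
    have h3 := hlam i
    omega
  have h₁c := minorProduct_isHighest_colPol hn hadm.antitone μ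
  obtain ⟨hst, hgraph⟩ := eq_zero_of_mem_pair_stableSpan hlam hg₁0 h₁c
    (minorProduct_isHighest_lowerRowGen hn hμ hle) (minorProduct_isHighest_colPol hn hμ μ)
    (minorProduct_isHighest_lowerRowGen hn hμ le_rfl)
  set Q := stableSpan (pairOp N n k) IsNonraising {(g₁, g₂)} with hQ
  have hgQ : (g₁, g₂) ∈ Q := subset_stableSpan rfl
  let W : Submodule ℂ (Poly N n) := Q.map (LinearMap.fst ℂ _ _)
  have hW : ∀ U : Submodule ℂ (Poly N n), IsStable N n U → g₁ ∈ U → W ≤ U := by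
    intro U hU hgU
    rw [Submodule.map_le_iff_le_comap]
    refine stableSpan_le (by simpa using hgU) ?_
    obtain ⟨h1, h2⟩ := isStable_iff.1 hU
    rintro (a | a) _ x hx
    · exact h1 _ _ x.1 hx
    · exact h2 _ _ x.1 hx
  have hgW : g₁ ∈ W := ⟨_, hgQ, rfl⟩
  have : FiniteDimensional ℂ W := Submodule.finiteDimensional_of_le
    (hW _ (isStable_restrictTotalDegree g₁.totalDegree) (mem_restrictTotalDegree_totalDegree g₁))
  let G : Fin N → Fin N → Op N n := fun i j =>
    lowerRowGen N n i j - colPol N n j i + (if i = j then (k : ℂ) else 0) • 1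
  have hGapp : ∀ i j f, G i j f =
      lowerRowGen N n i j f - colPol N n j i f + (if i = j then (k : ℂ) else 0) • f := by
    intro i j f
    rw [LinearMap.add_apply, LinearMap.sub_apply, LinearMap.smul_apply, Module.End.one_apply]
  have hGadj : ∀ i j f g, ⟪G i j f, g⟫_ℂ = ⟪f, G j i g⟫_ℂ := by
    intro i j f g
    rw [hGapp, hGapp, inner_add_left, inner_sub_left, inner_add_right, inner_sub_right,
      inner_lowerRowGen_left, inner_colPol_left, inner_smul_left, inner_smul_right]
    by_cases h : i = j
    · simp [h]
    · simp [h, Ne.symm h]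
  -- the twisted diagonal action on pairs
  have hGQ : ∀ i j, ∀ x ∈ Q, (G i j x.1, lowerRowGen N n i j x.2 - colPol N n j i x.2) ∈ Q := by
    intro i j x hx
    have h1 := Q.add_mem (Q.sub_mem (hst (.inl (i, j)) x hx) (hst (.inr (j, i)) x hx))
      (Q.smul_mem (if i = j then (k : ℂ) else 0) hx)
    convert h1 using 1
    refine Prod.ext ?_ ?_
    · rw [hGapp]; rfl
    · change _ = lowerRowGen N n i j x.2 - twistedColPol N n k j i x.2 + _ • x.2
      rw [twistedColPol_apply]
      simp only [eq_comm (a := j) (b := i)]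
      abel
  have hGW : ∀ i j, ∀ x ∈ W, G i j x ∈ W := by
    rintro i j _ ⟨x, hx, rfl⟩
    exact ⟨_, hGQ i j x hx, rfl⟩
  -- The adjoint of `G i j` is `G j i`, so the orthogonal complement of `K` in `W` is the joint
  -- kernel of the `G i j`, which lies in `hilbertPart`. If that is zero, `K` is all of `W`.
  let K : Submodule ℂ (Poly N n) := ⨆ p : Fin N × Fin N, W.map (G p.1 p.2)
  have hKW : K ≤ W := iSup_le fun p => by
    rw [Submodule.map_le_iff_le_comap]
    exact fun x hx => hGW _ _ x hx
  have : FiniteDimensional ℂ K := Submodule.finiteDimensional_of_le hKW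
  have hperp : Kᗮ ⊓ W = ⊥ := by
    refine (Submodule.eq_bot_iff _).2 fun x hx => ?_
    obtain ⟨hxK, hxW⟩ := hx
    have hG0 : ∀ i j, G i j x = 0 := by
      intro i j
      have h1 : ⟪G j i (G i j x), x⟫_ℂ = 0 := (Submodule.mem_orthogonal K x).1 hxK _
        (Submodule.mem_iSup_of_mem (j, i) ⟨_, hGW i j x hxW, rfl⟩)
      rw [hGadj] at h1
      exact inner_self_eq_zero.1 h1
    have hx : x ∈ hilbertPart N n k lam := by
      refine ⟨hW _ (isStable_component lam) (mem_component_of_isHighest hadm.antitone h₁c) hxW,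
        mem_hilbert_iff.2 fun i j => ?_⟩
      have h1 := hG0 i j
      rw [hGapp] at h1
      rw [eq_sub_iff_add_eq, ← sub_eq_zero, ← h1]
      abel
    rw [hbot] at hx
    exact (Submodule.mem_bot ℂ).1 hx
  have hKeq : K = W := by
    have := Submodule.sup_orthogonal_inf_of_hasOrthogonalProjection hKW
    rwa [hperp, sup_bot_eq] at this
  -- First coordinates of the pairs in `Q` whose second coordinate vanishes at the base point. It
  -- contains `K`, since the twist cancels `k` in the second coordinate, so `g₁` would lie in it.
  let Z : Submodule ℂ (Poly N n) := (Q ⊓ LinearMap.ker ((aeval fun p : Fin (n + N) × Fin N =>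
    basePoint N n p.1 p.2).toLinearMap ∘ₗ LinearMap.snd ℂ (Poly N n) (Poly N n))).map
      (LinearMap.fst ℂ _ _)
  have hKZ : K ≤ Z := iSup_le fun p => by
    rintro _ ⟨_, ⟨x, hx, rfl⟩, rfl⟩
    refine ⟨_, ⟨hGQ p.1 p.2 x hx, ?_⟩, rfl⟩
    change evalMat (basePoint N n)
      (lowerRowGen N n p.1 p.2 x.2 - colPol N n p.2 p.1 x.2) = 0
    rw [map_sub, evalMat_basePoint_lowerRowGen, sub_self]
  obtain ⟨y, ⟨hyQ, hy0⟩, hy1⟩ := hKZ (hKeq ▸ hgW)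
  -- The graph property identifies the partner of `g₁` as `g₂`, whose value at the base point is 1.
  have hy2 : y.2 = g₂ := by
    have h1 : y - (g₁, g₂) = (0, y.2 - g₂) := Prod.ext (sub_eq_zero.2 hy1) rfl
    have h2 := hgraph (y.2 - g₂) (h1 ▸ Q.sub_mem hyQ hgQ)
    exact sub_eq_zero.1 h2
  have hy3 : evalMat (basePoint N n) y.2 = 0 := hy0
  rw [hy2, evalMat_basePoint_minorProduct] at hy3
  exact one_ne_zero hy3

end Existence

/-! ### The Hamiltonian as a Casimir operator, and the spectral decomposition. -/

section Hamiltonian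

variable {N n k : ℕ}

/-- The quadratic Casimir operator of the column polarizations. -/
def colCasimir (N n : ℕ) : Op N n := ∑ i, ∑ j, colPol N n i j * colPol N n j i

theorem hamiltonian_eq :
    hamiltonian N n = ∑ i, ∑ j, lowerRowGen N n i j * lowerRowGen N n j i := by
  have h : ∀ i j, (opX N n * opY N n) i j = lowerRowGen N n i j := fun i j => by
    rw [Matrix.mul_apply]; rfl
  simp only [hamiltonian, Matrix.trace, Matrix.diag, pow_two, Matrix.mul_apply (M := _ * _), h]

theorem mul_commutator {R : Type*} [Ring R] (a b c : R) :
    a * b * c - c * (a * b) = a * (b * c - c * b) + (a * c - c * a) * b := by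
  noncomm_ring

/-- The commutator with each product gives four Kronecker terms, which cancel in pairs after
summation. -/
theorem colCasimir_mul_colPol (a b : Fin N) :
    colCasimir N n * colPol N n a b = colPol N n a b * colCasimir N n := by
  have h : ∀ i j, colPol N n i j * colPol N n j i * colPol N n a b -
      colPol N n a b * (colPol N n i j * colPol N n j i) =
      ((if i = a then colPol N n i j * colPol N n j b else 0) -
        (if b = j then colPol N n i j * colPol N n a i else 0)) +
      ((if j = a then colPol N n i b * colPol N n j i else 0) -
        (if b = i then colPol N n a j * colPol N n j i else 0)) := by
    intro i j
    rw [mul_commutator, colPol_commutator, colPol_commutator, mul_sub, sub_mul]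
    simp only [mul_ite, ite_mul, mul_zero, zero_mul]
  rw [← sub_eq_zero]
  simp only [colCasimir, Finset.sum_mul, Finset.mul_sum, ← Finset.sum_sub_distrib]
  simp only [h, Finset.sum_add_distrib, Finset.sum_sub_distrib]
  have h1 : ∑ i, ∑ j, (if i = a then colPol N n i j * colPol N n j b else 0) =
      ∑ j, colPol N n a j * colPol N n j b := by
    rw [Finset.sum_comm]; simp
  have h4 : ∑ i, ∑ j, (if b = i then colPol N n a j * colPol N n j i else 0) =
      ∑ j, colPol N n a j * colPol N n j b := by
    rw [Finset.sum_comm]; simp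
  rw [h1, h4]
  simp

/-- On a highest weight vector C^i_j C^j_i acts as λ_i - λ_j for i < j, as λ_i² for i = j, and as 0
for i > j. -/
theorem colCasimir_apply_of_isHighest {lam : Fin N → ℕ} {v : Poly N n}
    (hv : IsHighest (colPol N n) (fun i => (lam i : ℂ)) v) :
    colCasimir N n v = (∑ i : Fin N, (lam i : ℂ) * (lam i + N - 1 - 2 * (i : ℕ))) • v := by
  have h : ∀ i j, colPol N n i j (colPol N n j i v) =
      ((if i = j then (lam i : ℂ) * lam i else 0) +
        ((if i < j then (lam i : ℂ) else 0) - (if i < j then (lam j : ℂ) else 0))) • v := by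
    intro i j
    rcases lt_trichotomy i j with hij | rfl | hij
    · have := LinearMap.congr_fun (colPol_commutator (N := N) (n := n) i j j i) v
      simp only [if_true, LinearMap.sub_apply, Module.End.mul_apply, hv.raising i j hij, map_zero,
        sub_zero, hv.weight] at this
      simp only [if_neg hij.ne, if_pos hij, zero_add, this, sub_smul]
    · rw [hv.weight, map_smul, hv.weight, smul_smul]
      simp
    · rw [hv.raising j i hij, map_zero]
      simp [hij.ne', hij.not_gt]
  simp only [colCasimir, LinearMap.sum_apply, Module.End.mul_apply, h, ← Finset.sum_smul]
  congr 1
  simp only [Finset.sum_add_distrib, Finset.sum_sub_distrib]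
  have h1 : ∑ i : Fin N, ∑ j : Fin N, (if i = j then (lam i : ℂ) * lam i else 0) =
      ∑ i : Fin N, (lam i : ℂ) * lam i := by simp
  have h2 : ∑ i : Fin N, ∑ j : Fin N, (if i < j then (lam i : ℂ) else 0) =
      ∑ i : Fin N, (lam i : ℂ) * (N - 1 - (i : ℕ)) := by
    refine Finset.sum_congr rfl fun i _ => ?_
    rw [← Finset.sum_filter, Finset.sum_const, nsmul_eq_mul, mul_comm, Finset.filter_lt_eq_Ioi,
      Fin.card_Ioi, Nat.sub_sub, Nat.cast_sub (by omega)]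
    push_cast
    ring
  have h3 : ∑ i : Fin N, ∑ j : Fin N, (if i < j then (lam j : ℂ) else 0) =
      ∑ i : Fin N, (lam i : ℂ) * (i : ℕ) := by
    rw [Finset.sum_comm]
    refine Finset.sum_congr rfl fun i _ => ?_
    rw [← Finset.sum_filter, Finset.sum_const, nsmul_eq_mul, mul_comm, Finset.filter_gt_eq_Iio,
      Fin.card_Iio]
  rw [h1, h2, h3, ← Finset.sum_sub_distrib, ← Finset.sum_add_distrib]
  exact Finset.sum_congr rfl fun i _ => by ring

theorem sum_colPol_apply_of_isHighest {lam : Fin N → ℕ} {v : Poly N n}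
    (hv : IsHighest (colPol N n) (fun i => (lam i : ℂ)) v) :
    (∑ i, colPol N n i i) v = (∑ i : Fin N, (lam i : ℂ)) • v := by
  simp only [LinearMap.sum_apply, hv.weight, Finset.sum_smul]

/-- An operator commuting with the column polarizations acts by a scalar on an isotypic subspace
if it does so on highest weight vectors. -/
theorem apply_eq_smul_of_mem_isotypic {w : Fin N → ℂ} {T : Op N n} {c : ℂ}
    (hT : ∀ i j, T * colPol N n i j = colPol N n i j * T)
    (hv : ∀ v, IsHighest (colPol N n) w v → T v = c • v) {f : Poly N n}
    (hf : f ∈ isotypic (colPol N n) w) : T f = c • f := by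
  have h : isotypic (colPol N n) w ≤ Module.End.eigenspace T c := by
    refine stableSpan_le (fun v hv' => Module.End.mem_eigenspace_iff.2 (hv v hv')) ?_
    intro a _ x hx
    rw [Module.End.mem_eigenspace_iff] at hx ⊢
    have h1 := LinearMap.congr_fun (hT a.1 a.2) x
    simp only [Module.End.mul_apply] at h1
    change T (colPol N n a.1 a.2 x) = c • colPol N n a.1 a.2 x
    rw [h1, hx, map_smul]
  exact Module.End.mem_eigenspace_iff.1 (h hf)

theorem sum_colPol_mul_colPol (a b : Fin N) :
    (∑ i, colPol N n i i) * colPol N n a b = colPol N n a b * ∑ i, colPol N n i i := by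
  rw [← sub_eq_zero, Finset.sum_mul, Finset.mul_sum, ← Finset.sum_sub_distrib]
  simp [colPol_commutator]

/-- The relation L = C - kδ holds only on `f`, so it is used on the inner factor first. Then the
outer L is commuted past C to reach `f`, which also makes C^i_j C^j_i appear in the Casimir order.
-/
theorem hamiltonian_apply_of_mem_hilbert {f : Poly N n} (hf : f ∈ hilbert N n k) :
    hamiltonian N n f = colCasimir N n f - (2 * k : ℂ) • (∑ i, colPol N n i i) f +
      ((N : ℂ) * k ^ 2) • f := by
  rw [mem_hilbert_iff] at hf
  have h : ∀ i j, lowerRowGen N n i j (lowerRowGen N n j i f) =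
      colPol N n i j (colPol N n j i f) -
        (if i = j then (2 * k : ℂ) • colPol N n i j f else 0) +
        (if i = j then ((k : ℂ) ^ 2) • f else 0) := by
    intro i j
    have h1 := LinearMap.congr_fun (lowerRowGen_mul_colPol (N := N) (n := n) i j i j) f
    simp only [Module.End.mul_apply] at h1
    rw [hf j i, map_sub, map_smul, h1, hf i j, map_sub, map_smul]
    by_cases hij : i = j
    · subst hij
      simp only [if_true]
      module
    · simp [hij, Ne.symm hij]
  simp only [hamiltonian_eq, colCasimir, LinearMap.sum_apply, Module.End.mul_apply, h,
    Finset.sum_add_distrib, Finset.sum_sub_distrib, Finset.sum_ite_eq, Finset.mem_univ, if_true,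
    Finset.smul_sum, Finset.sum_const, Finset.card_univ, Fintype.card_fin]
  rw [← Nat.cast_smul_eq_nsmul ℂ, smul_smul]

theorem energy_eq (lam : Fin N → ℕ) : (energy N k lam : ℂ) =
    ∑ i : Fin N, (lam i : ℂ) * (lam i + N - 1 - 2 * (i : ℕ)) -
      2 * k * ∑ i : Fin N, (lam i : ℂ) + N * k ^ 2 := by
  -- These shifts sum to zero, so the term linear in `k` of the energy contains no multiple of `N`.
  have h0 : ∑ i : Fin N, ((N : ℂ) - 1 - 2 * (i : ℕ)) = 0 := by
    have h1 : (∑ i : Fin N, ((i : ℕ) : ℂ)) * 2 = N * (N - 1) := by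
      rw [Fin.sum_univ_eq_sum_range (fun i => (i : ℂ)) N, ← Nat.cast_sum, ← Nat.cast_two,
        ← Nat.cast_mul, Finset.sum_range_id_mul_two]
      rcases N with _ | N
      · simp
      · push_cast; simp
    rw [Finset.sum_sub_distrib, ← Finset.mul_sum, Finset.sum_const, Finset.card_univ,
      Fintype.card_fin, nsmul_eq_mul, mul_comm (2 : ℂ), h1, sub_self]
  have h2 : (N : ℂ) * k ^ 2 = ∑ i : Fin N, (k : ℂ) ^ 2 := by simp
  have h3 : (energy N k lam : ℂ) = ∑ i : Fin N, ((lam i : ℂ) * (lam i + N - 1 - 2 * (i : ℕ)) -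
      2 * k * lam i + k ^ 2) - k * ∑ i : Fin N, ((N : ℂ) - 1 - 2 * (i : ℕ)) := by
    rw [Finset.mul_sum, ← Finset.sum_sub_distrib, energy, Int.cast_sum]
    refine Finset.sum_congr rfl fun i _ => ?_
    push_cast
    ring
  rw [h3, h0, mul_zero, sub_zero, h2, Finset.mul_sum, ← Finset.sum_sub_distrib,
    ← Finset.sum_add_distrib]

theorem hamiltonian_apply_of_mem_hilbertPart {lam : Fin N → ℕ} {f : Poly N n}
    (hf : f ∈ hilbertPart N n k lam) :
    hamiltonian N n f = (energy N k lam : ℂ) • f := by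
  have hiso := component_le_isotypic_colPol lam hf.1
  rw [hamiltonian_apply_of_mem_hilbert hf.2,
    apply_eq_smul_of_mem_isotypic colCasimir_mul_colPol
      (fun v hv => colCasimir_apply_of_isHighest hv) hiso,
    apply_eq_smul_of_mem_isotypic sum_colPol_mul_colPol
      (fun v hv => sum_colPol_apply_of_isHighest hv) hiso, energy_eq, smul_smul, ← sub_smul,
      ← add_smul]

theorem hilbertPart_isOrtho {lam lam' : Fin N → ℕ} (h : lam ≠ lam') :
    hilbertPart N n k lam ⟂ hilbertPart N n k lam' :=
  (component_isOrtho h).mono inf_le_left inf_le_left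

theorem iSupIndep_hilbertPart :
    iSupIndep fun lam : {lam : Fin N → ℕ // IsAdmissible N n k lam} => hilbertPart N n k lam :=
  (OrthogonalFamily.of_pairwise fun _ _ h =>
    hilbertPart_isOrtho fun h' => h (Subtype.ext h')).independent

/-- The shifted moment operators preserve the orthogonal components, so their common kernel splits;
nonadmissible diagrams contribute zero. -/
theorem hilbert_le_iSup_hilbertPart (hk : 0 < k) : hilbert N n k ≤
    ⨆ lam : {lam : Fin N → ℕ // IsAdmissible N n k lam}, hilbertPart N n k lam := by
  intro f hf
  let T : Fin N × Fin N → Op N n := fun p =>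
    momentMap N n p.1 p.2 + if p.1 = p.2 then (k : ℂ) • (1 : Op N n) else 0
  have hTapp : ∀ p g, T p g = lowerRowGen N n p.1 p.2 g - colPol N n p.2 p.1 g +
      (if p.1 = p.2 then (k : ℂ) else 0) • g := by
    intro p g
    simp only [T, LinearMap.add_apply, momentMap_eq, LinearMap.sub_apply]
    split_ifs <;> simp
  have hTker : ⨅ p, LinearMap.ker (T p) = hilbert N n k := by
    rw [hilbert, iInf_prod]
  have h1 := mem_iSup_inf_ker
    (K := fun lam : {lam : Fin N → ℕ // Antitone lam} => component N n lam) (T := T)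
    (fun lam lam' h => component_isOrtho fun h' => h (Subtype.ext h'))
    (fun p lam x hx => by
      obtain ⟨h2, h3⟩ := isStable_iff.1 (isStable_component (n := n) lam.1)
      rw [hTapp]
      exact Submodule.add_mem _ (Submodule.sub_mem _ (h2 _ _ x hx) (h3 _ _ x hx))
        (Submodule.smul_mem _ _ hx))
    (by rw [iSup_component_eq_top]; exact Submodule.mem_top (x := f))
    (fun p => by
      rw [← hTker, Submodule.mem_iInf] at hf
      exact LinearMap.mem_ker.1 (hf p))
  rw [hTker] at h1
  refine SetLike.le_def.1 (iSup_le fun lam => ?_) h1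
  by_cases hbot : hilbertPart N n k lam.1 = ⊥
  · exact hbot.le.trans bot_le
  · exact le_iSup (fun lam : {lam : Fin N → ℕ // IsAdmissible N n k lam} =>
      hilbertPart N n k lam) ⟨lam.1, isAdmissible_of_hilbertPart_ne_bot hk hbot⟩

/-- The same splitting for the kernel of H_CS - c: a part on which the scalar differs from `c` meets
this kernel in zero. -/
theorem eigenspace_inf_hilbert_le (hk : 0 < k) (c : ℂ) :
    Module.End.eigenspace (hamiltonian N n) c ⊓ hilbert N n k ≤
      ⨆ lam : {lam : Fin N → ℕ // IsAdmissible N n k lam ∧ (energy N k lam : ℂ) = c},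
        hilbertPart N n k lam := by
  rintro f ⟨hfc, hf⟩
  have h1 := mem_iSup_inf_ker
    (K := fun lam : {lam : Fin N → ℕ // IsAdmissible N n k lam} => hilbertPart N n k lam)
    (T := fun _ : Unit => hamiltonian N n - c • 1)
    (fun lam lam' h => hilbertPart_isOrtho fun h' => h (Subtype.ext h'))
    (fun _ lam x hx => by
      rw [LinearMap.sub_apply, LinearMap.smul_apply, Module.End.one_apply,
        hamiltonian_apply_of_mem_hilbertPart hx]
      exact Submodule.sub_mem _ (Submodule.smul_mem _ _ hx) (Submodule.smul_mem _ _ hx))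
    (hilbert_le_iSup_hilbertPart hk hf)
    (fun _ => by
      rw [LinearMap.sub_apply, LinearMap.smul_apply, Module.End.one_apply,
        Module.End.mem_eigenspace_iff.1 hfc, sub_self])
  refine SetLike.le_def.1 (iSup_le fun lam => ?_) h1
  rintro x ⟨hx, hxc⟩
  have h2 := LinearMap.mem_ker.1 ((Submodule.mem_iInf _).1 hxc ())
  rw [LinearMap.sub_apply, LinearMap.smul_apply, Module.End.one_apply,
    hamiltonian_apply_of_mem_hilbertPart hx, ← sub_smul, smul_eq_zero, sub_eq_zero] at h2
  rcases h2 with h2 | h2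
  · exact Submodule.mem_iSup_of_mem (p := fun lam : {lam : Fin N → ℕ //
      IsAdmissible N n k lam ∧ (energy N k lam : ℂ) = c} => hilbertPart N n k lam)
      ⟨lam.1, lam.2, h2⟩ hx
  · rw [h2]; exact zero_mem _

end Hamiltonian

end ChernSimonsMatrix

end

/-! ### Assembly of the theorem. -/

theorem mainTheorem12 (N n k : ℕ) (hN : 0 < N) (hn : 0 < n) (hk : 0 < k) :
    -- `H_CS` acts on `H_N(n, k)`
    (∀ f ∈ ChernSimonsMatrix.hilbert N n k,
      ChernSimonsMatrix.hamiltonian N n f ∈ ChernSimonsMatrix.hilbert N n k) ∧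
    -- `H_N(n, k)` is the direct sum of the parts of the admissible diagrams
    iSupIndep (fun lam : {lam : Fin N → ℕ // ChernSimonsMatrix.IsAdmissible N n k lam} =>
      ChernSimonsMatrix.hilbertPart N n k lam) ∧
    (⨆ lam : {lam : Fin N → ℕ // ChernSimonsMatrix.IsAdmissible N n k lam},
      ChernSimonsMatrix.hilbertPart N n k lam) = ChernSimonsMatrix.hilbert N n k ∧
    -- each part is nonzero and `H_CS` acts on it by the stated eigenvalue
    (∀ lam : Fin N → ℕ, ChernSimonsMatrix.IsAdmissible N n k lam →
      ChernSimonsMatrix.hilbertPart N n k lam ≠ ⊥ ∧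
      ∀ f ∈ ChernSimonsMatrix.hilbertPart N n k lam,
        ChernSimonsMatrix.hamiltonian N n f =
          (ChernSimonsMatrix.energy N k lam : ℂ) • f) ∧
    -- hence every eigenspace of `H_CS` on `H_N(n, k)` is the sum of the parts with that eigenvalue
    (∀ c : ℂ, Module.End.eigenspace (ChernSimonsMatrix.hamiltonian N n) c ⊓
        ChernSimonsMatrix.hilbert N n k =
      ⨆ lam : {lam : Fin N → ℕ // ChernSimonsMatrix.IsAdmissible N n k lam ∧
          (ChernSimonsMatrix.energy N k lam : ℂ) = c},
        ChernSimonsMatrix.hilbertPart N n k lam) := by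
  have hle : ∀ lam : Fin N → ℕ, ChernSimonsMatrix.hilbertPart N n k lam ≤
      ChernSimonsMatrix.hilbert N n k := fun _ => inf_le_right
  have hsup : (⨆ lam : {lam : Fin N → ℕ // ChernSimonsMatrix.IsAdmissible N n k lam},
      ChernSimonsMatrix.hilbertPart N n k lam) = ChernSimonsMatrix.hilbert N n k :=
    le_antisymm (iSup_le fun lam => hle lam)
      (ChernSimonsMatrix.hilbert_le_iSup_hilbertPart hk)
  have heig : ∀ lam : Fin N → ℕ, ∀ f ∈ ChernSimonsMatrix.hilbertPart N n k lam,
      ChernSimonsMatrix.hamiltonian N n f = (ChernSimonsMatrix.energy N k lam : ℂ) • f :=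
    fun _ _ hf => ChernSimonsMatrix.hamiltonian_apply_of_mem_hilbertPart hf
  refine ⟨?_, ?_, hsup, fun lam hlam =>
    ⟨ChernSimonsMatrix.hilbertPart_ne_bot hn hlam, heig lam⟩, fun c => ?_⟩
  -- Invariance of H_N(n,k) is read off from the decomposition: the Hamiltonian is scalar on each
  -- summand, so no commutation with the moment map is needed.
  · have h : (⨆ lam : {lam : Fin N → ℕ // ChernSimonsMatrix.IsAdmissible N n k lam},
        ChernSimonsMatrix.hilbertPart N n k lam) ≤
        (ChernSimonsMatrix.hilbert N n k).comap (ChernSimonsMatrix.hamiltonian N n) := by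
      refine iSup_le fun lam f hf => ?_
      rw [Submodule.mem_comap, heig lam f hf]
      exact Submodule.smul_mem _ _ (hle lam hf)
    rw [hsup] at h
    exact h
  · exact ChernSimonsMatrix.iSupIndep_hilbertPart
  · refine le_antisymm (ChernSimonsMatrix.eigenspace_inf_hilbert_le hk c)
      (iSup_le fun lam f hf => ⟨?_, hle lam hf⟩)
    rw [SetLike.mem_coe, Module.End.mem_eigenspace_iff, heig lam f hf, lam.2.2]
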